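/- For positive integers $k_1,\dots,k_r$, an integer $n\ge 0$ and $a\in\mathbb{C}\setminus\{0,-1,-2,\dots\}$ put $$\zeta_n(k_1,\dots,k_r;a)=\sum_{n\ge n_1>\cdots>n_r>0}\prod_{j=1}^r\frac1{(n_j+a-1)^{k_j}},\qquad \zeta^\star_n(k_1,\dots,k_r)=\sum_{n\ge n_1\ge\cdots\ge n_r>0}\prod_{j=1}^r\frac1{n_j^{k_j}},$$ with value $1$ for the empty index, and, if $k_1\ge 2$ or the index is empty, $\zeta(k_1,\dots,k_r;a)=\lim_{n\to\infty}\zeta_n(k_1,\dots,k_r;a)$ and $\zeta(k_1,\dots,k_r)=\zeta(k_1,\dots,k_r;1)$. Let $\{1\}_k$ be the sequence of $k$ ones and $\binom{a}{b}=\frac{\Gamma(a+1)}{\Gamma(b+1)\Gamma(a-b+1)}$. For a composition $\boldsymbol{k}$ let $\boldsymbol{k}^\vee$ be its Hoffman dual, obtained from $\boldsymbol{k}=(1+\cdots+1,\dots,1+\cdots+1)$ by interchanging commas and plus signs. Let $\delta_{0,k}$ be $1$ if $k=0$ and $0$ otherwise. **Theorem.** Let $k\ge 0$ and $p\ge 1$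 be integers, let $\alpha\in\mathbb{C}\setminus\mathbb{Z}$ with $\Re(\alpha)<1$, and let $m_1,\dots,m_p$ be positive integers with $m_1,m_p\ge 2$. Then all the series and limits below converge, the derivative exists, and $$\sum_{j=1}^p(-1)^{j-1}\zeta(m_p,\dots,m_{j+1})\sum_{n=1}^\infty\binom{n+\alpha-1}{n}\frac{\zeta_n(\{1\}_k;\alpha)\,\zeta^\star_n\big((m_1-1,m_2,\dots,m_j)^\vee\big)}{n}$$ $$=\frac1{k!}\frac{d^k}{d\alpha^k}\zeta(m_p,\dots,m_1;1-\alpha)-\delta_{0,k}\,\zeta(m_p,\dots,m_1)$$ $$=\sum_{\substack{i_1+\cdots+i_p=k\\ i_1,\dots,i_p\ge0}}\left\{\prod_{j=1}^p\binom{m_j+i_j-1}{i_j}\right\}\zeta(m_p+i_p,\dots,m_1+i_1;1-\alpha)-\delta_{0,k}\,\zeta(m_p,\dots,m_1).$$ -/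

import Mathlib

open Filter Topology

namespace HurwitzMZV

/-- The generalized binomial coefficient `Γ(a+1) / (Γ(b+1) Γ(a-b+1))`. -/
noncomputable def gbinom (a b : ℂ) : ℂ :=
  Complex.Gamma (a + 1) / (Complex.Gamma (b + 1) * Complex.Gamma (a - b + 1))

/-- The Hurwitz-type multiple harmonic sum
`ζ_n(k₁,…,k_r; a) = ∑_{n ≥ n₁ > ⋯ > n_r > 0} ∏_j (n_j + a - 1)^{-k_j}`, written as an iterated sum
(outermost variable `n₁`, the others being at most `n₁ - 1`); `ζ_n(∅; a) = 1`. -/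
noncomputable def mhs : List ℕ → ℂ → ℕ → ℂ
  | [], _, _ => 1
  | k :: ks, a, n => ∑ n₁ ∈ Finset.Icc 1 n, 1 / ((n₁ : ℂ) + a - 1) ^ k * mhs ks a (n₁ - 1)

/-- The multiple harmonic star sum
`ζ⋆_n(k₁,…,k_r) = ∑_{n ≥ n₁ ≥ ⋯ ≥ n_r > 0} ∏_j n_j^{-k_j}`; `ζ⋆_n(∅) = 1`. -/
noncomputable def mhss : List ℕ → ℕ → ℂ
  | [], _ => 1
  | k :: ks, n => ∑ n₁ ∈ Finset.Icc 1 n, 1 / (n₁ : ℂ) ^ k * mhss ks n₁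

/-- The Hurwitz-type multiple zeta value `ζ(k₁,…,k_r; a) = lim_{n → ∞} ζ_n(k₁,…,k_r; a)`. -/
noncomputable def hmzv (k : List ℕ) (a : ℂ) : ℂ := limUnder atTop (mhs k a)

/-- The multiple zeta value `ζ(k₁,…,k_r) = ζ(k₁,…,k_r; 1)`; `ζ(∅) = 1`. -/
noncomputable def mzv (k : List ℕ) : ℂ := hmzv k 1

/-- The separators between consecutive `1`s when a composition `(k₁,…,k_r)` is written as
`(1+⋯+1, …, 1+⋯+1)` with `k_j` ones in the `j`-th block: `true` is a comma, `false` a plus sign. -/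
def separators : List ℕ → List Bool
  | [] => []
  | [k] => List.replicate (k - 1) false
  | k :: k' :: ks => List.replicate (k - 1) false ++ true :: separators (k' :: ks)

/-- The composition with a given list of separators (`true` a comma, `false` a plus sign). -/
def ofSeparators : List Bool → List ℕ
  | [] => [1]
  | true :: s => 1 :: ofSeparators s
  | false :: s => (ofSeparators s).modifyHead (· + 1)

/-- The Hoffman dual `k^∨` of a composition: swap commas and plus signs in
`k = (1+⋯+1, …, 1+⋯+1)`. -/
def hoffmanDual : List ℕ → List ℕ
  | [] => []
  | k :: ks => ofSeparators ((separators (k :: ks)).map not)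

/-- The `n`-th term `binom(n+α-1, n) ζ_n({1}_k; α) ζ⋆_n(l) / n` of the Apéry-type series. -/
noncomputable def aperyTerm (k : ℕ) (α : ℂ) (l : List ℕ) (n : ℕ) : ℂ :=
  gbinom (n + α - 1) n * (mhs (List.replicate k 1) α n * mhss l n / n)

end HurwitzMZV

/-! The case `k = 0` carries everything. Since `binom(n+α-1, n) = (α)_n / n!`, the inner series is
then a Newton series `newtonSum e α`, where `e = starTerm w` and `w` is the complemented separator
word of `(m_1, …, m_j)`. Its negative `starInterp` interpolates `N ↦ ζ⋆_N(m_1, …, m_j)` at `α = -N`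
and inherits the difference equation of the star sums (`starInterp_cons_sub_one`).

Weighting these interpolations by `(-1)^j ζ(m_p, …, m_{j+1})` gives `antipodeSum`. At `α = -N` this
is the familiar antipode expression for the tail sum over `n_1 > ⋯ > n_p > N`, that is, for a
Hurwitz value at `1 + N`. For general `α` with `Re α < 1`, `antipodeSum` and the Hurwitz value
satisfy the same difference equation under `α ↦ α - 1`. By induction on depth their difference `d`
is 1-periodic, and `d 0 = 0`. A difference equation alone leaves room for a periodic function; what
excludes it is `d (α - N) - d (-N) → 0`.

That limit rests on complete monotonicity. Shifting `α` by `-N` replaces `e` by its `N`-th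
difference, up to a sum independent of `α` (`newtonSum_sub_natCast`). For `starTerm` these
differences lie between `0` and `e` and tend to `0`, so dominated convergence applies
(`tendsto_newtonSum_iterDiff`).

General `k` follows by taking the `k`-th Taylor coefficient in `α`: on `(α)_n / n!` it produces the
factor `ζ_n({1}_k; α)` (`taylorCoeff_riseRatio`), and on truncated Hurwitz sums the binomial weights
(`taylorCoeff_mhs`). Locally uniform convergence allows this termwise. -/

namespace HurwitzMZV

/-! ### Iterated differences and complete monotonicity -/

/-- The iterated difference `D^N e` with `(D e) n = e n - e (n + 1)`. -/
def iterDiff (e : ℕ → ℝ) : ℕ → ℕ → ℝ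
  | 0, n => e n
  | N + 1, n => iterDiff e N n - iterDiff e N (n + 1)

/-- Leibniz rule for differences of the product `(n + 1) * c n`: only two terms survive because one
factor is linear. -/
lemma iterDiff_div {a c : ℕ → ℝ} (h : ∀ n : ℕ, ((n : ℝ) + 1) * c n = a n) (N n : ℕ) :
    ((n : ℝ) + 1) * iterDiff c (N + 1) n =
      (N + 1) * iterDiff c N (n + 1) + iterDiff a (N + 1) n := by
  induction N generalizing n with
  | zero =>
    have h1 := h n
    have h2 := h (n + 1)
    push_cast at h2
    simp only [iterDiff]
    push_cast
    linear_combination h1 - h2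
  | succ N ih =>
    have h1 := ih n
    have h2 := ih (n + 1)
    push_cast at h2 ⊢
    rw [show iterDiff c (N + 1 + 1) n = iterDiff c (N + 1) n - iterDiff c (N + 1) (n + 1) from rfl,
      show iterDiff a (N + 1 + 1) n = iterDiff a (N + 1) n - iterDiff a (N + 1) (n + 1) from rfl]
    have h3 : iterDiff c (N + 1) (n + 1) = iterDiff c N (n + 1) - iterDiff c N (n + 1 + 1) := rfl
    linear_combination h1 - h2 - ((N : ℝ) + 1) * h3

/-- With `a 0 = b 0`, the hypothesis says that `a n` is the mean of `b 0, …, b n`; the recursion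
survives differencing, with a shifted coefficient. -/
lemma iterDiff_avg_succ {a b : ℕ → ℝ}
    (h : ∀ n : ℕ, ((n : ℝ) + 2) * a (n + 1) = (n + 1) * a n + b (n + 1)) (N n : ℕ) :
    ((n : ℝ) + N + 2) * iterDiff a N (n + 1) =
      (n + 1) * iterDiff a N n + iterDiff b N (n + 1) := by
  induction N generalizing n with
  | zero => simpa [iterDiff] using h n
  | succ N ih =>
    have h1 := ih n
    have h2 := ih (n + 1)
    push_cast at h2 ⊢
    simp only [iterDiff]
    linear_combination h1 - h2

lemma iterDiff_avg_zero {a b : ℕ → ℝ} (h0 : a 0 = b 0)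
    (h : ∀ n : ℕ, ((n : ℝ) + 2) * a (n + 1) = (n + 1) * a n + b (n + 1)) (N : ℕ) :
    ((N : ℝ) + 1) * iterDiff a N 0 = iterDiff b N 0 := by
  induction N with
  | zero => simpa [iterDiff] using h0
  | succ N ih =>
    have h1 := iterDiff_avg_succ h N 0
    push_cast at h1 ⊢
    simp only [iterDiff]
    simp only [zero_add] at h1 ⊢
    linear_combination ih - h1

/-- All iterated differences are nonnegative and tend to zero. -/
structure CompletelyMonotone (e : ℕ → ℝ) : Prop where
  nonneg : ∀ N n, 0 ≤ iterDiff e N n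
  tendsto : ∀ n, Tendsto (fun N => iterDiff e N n) atTop (𝓝 0)

lemma iterDiff_le_of_nonneg {e : ℕ → ℝ} (h : ∀ N n, 0 ≤ iterDiff e N n) (N n : ℕ) :
    iterDiff e N n ≤ e n := by
  induction N with
  | zero => rfl
  | succ N ih =>
    have := h N (n + 1)
    simp only [iterDiff]
    linarith

/-- Since `D^N e (n+1) = D^N e n - D^(N+1) e n`, the limit at `0` propagates to every `n`. -/
lemma completelyMonotone_of_nonneg {e : ℕ → ℝ} (h : ∀ N n, 0 ≤ iterDiff e N n)
    (h0 : Tendsto (fun N => iterDiff e N 0) atTop (𝓝 0)) : CompletelyMonotone e := by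
  refine ⟨h, fun n => ?_⟩
  induction n with
  | zero => exact h0
  | succ n ih =>
    have h1 := ih.sub (ih.comp (tendsto_add_atTop_nat 1))
    rw [sub_zero] at h1
    refine h1.congr fun N => ?_
    simp [iterDiff]

lemma CompletelyMonotone.avg {a b : ℕ → ℝ} (hb : CompletelyMonotone b) (h0 : a 0 = b 0)
    (h : ∀ n : ℕ, ((n : ℝ) + 2) * a (n + 1) = (n + 1) * a n + b (n + 1)) : CompletelyMonotone a := by
  have hz : ∀ N, iterDiff a N 0 = iterDiff b N 0 / (N + 1) := fun N => by
    rw [eq_div_iff (by positivity), ← iterDiff_avg_zero h0 h N, mul_comm]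
  refine completelyMonotone_of_nonneg (fun N n => ?_) ?_
  · induction n with
    | zero =>
      rw [hz]
      exact div_nonneg (hb.nonneg N 0) (by positivity)
    | succ n ih =>
      have h1 := iterDiff_avg_succ h N n
      have h2 := hb.nonneg N (n + 1)
      by_contra hneg
      have : ((n : ℝ) + N + 2) * iterDiff a N (n + 1) < 0 :=
        mul_neg_of_pos_of_neg (by positivity) (not_le.mp hneg)
      have : 0 ≤ ((n : ℝ) + 1) * iterDiff a N n := by positivity
      linarith
  · refine squeeze_zero (fun N => ?_) (fun N => ?_) (hb.tendsto 0)
    · rw [hz]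
      exact div_nonneg (hb.nonneg N 0) (by positivity)
    · rw [hz]
      exact div_le_self (hb.nonneg N 0) (by linarith [(Nat.cast_nonneg N : (0 : ℝ) ≤ N)])

lemma completelyMonotone_div {a c : ℕ → ℝ} (ha : ∀ N n, 0 ≤ iterDiff a N n)
    (ha0 : Tendsto (fun N => iterDiff a N 0) atTop (𝓝 0))
    (h : ∀ n : ℕ, ((n : ℝ) + 1) * c n = a n) : CompletelyMonotone c := by
  refine completelyMonotone_of_nonneg (fun N => ?_) ?_
  · induction N with
    | zero =>
      intro n
      have h1 := ha 0 n
      simp only [iterDiff] at h1 ⊢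
      rw [← h n] at h1
      exact nonneg_of_mul_nonneg_right h1 (by positivity)
    | succ N ih =>
      intro n
      have h1 := iterDiff_div h N n
      have h2 := ha (N + 1) n
      have h3 := ih (n + 1)
      refine nonneg_of_mul_nonneg_right (a := (n : ℝ) + 1) ?_ (by positivity)
      rw [h1]
      positivity
  -- Division by `n + 1` becomes averaging of the differences at `0`, so the limit is a Cesàro
  -- limit. Together with `iterDiff_avg_zero` this is the mechanism of Hoffman duality.
  · have hsum : ∀ N : ℕ, ((N : ℝ) + 1) * iterDiff c N 0 =
        ∑ i ∈ Finset.range (N + 1), iterDiff a i 0 := by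
      intro N
      induction N with
      | zero => simpa [iterDiff] using h 0
      | succ N ih =>
        rw [Finset.sum_range_succ, ← ih]
        have h1 := iterDiff_div h N 0
        have h2 : iterDiff c (N + 1) 0 = iterDiff c N 0 - iterDiff c N (0 + 1) := rfl
        push_cast at h1 ⊢
        linear_combination h1 + ((N : ℝ) + 1) * h2
    have h1 := (ha0.cesaro).comp (tendsto_add_atTop_nat 1)
    refine h1.congr fun N => ?_
    simp only [Function.comp_apply]
    rw [← hsum N]
    push_cast
    field_simp

/-- For a word `s` of separators, the summand `ζ⋆_{n+1}(l₂, …, l_r) / (n + 1) ^ l₁` of the star sum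
of the index `l` with separators `s`. -/
noncomputable def starTerm : List Bool → ℕ → ℝ
  | [], n => 1 / ((n : ℝ) + 1)
  | true :: s, n => (∑ i ∈ Finset.range (n + 1), starTerm s i) / ((n : ℝ) + 1)
  | false :: s, n => starTerm s n / ((n : ℝ) + 1)

lemma completelyMonotone_starTerm (s : List Bool) : CompletelyMonotone (starTerm s) := by
  induction s with
  | nil =>
    have h1 : ∀ N n, iterDiff (fun _ => (1 : ℝ)) (N + 1) n = 0 := by
      intro N
      induction N with
      | zero => simp [iterDiff]
      | succ N ih => intro n; rw [iterDiff, ih, ih, sub_zero]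
    refine completelyMonotone_div (a := fun _ => 1) (fun N n => ?_) ?_ (fun n => ?_)
    · cases N with
      | zero => simp [iterDiff]
      | succ N => rw [h1]
    · rw [← tendsto_add_atTop_iff_nat 1]
      simp [h1]
    · simp only [starTerm]
      field_simp
  | cons x s ih =>
    cases x with
    | false =>
      refine completelyMonotone_div ih.nonneg (ih.tendsto 0) fun n => ?_
      simp only [starTerm]
      field_simp
    | true =>
      refine ih.avg (by simp [starTerm]) fun n => ?_
      simp only [starTerm]
      rw [Finset.sum_range_succ _ (n + 1)]
      push_cast
      field_simp
      ring

lemma starTerm_nonneg (s : List Bool) (n : ℕ) : 0 ≤ starTerm s n :=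
  (completelyMonotone_starTerm s).nonneg 0 n

lemma sum_Icc_one {M : Type*} [AddCommMonoid M] (f : ℕ → M) (n : ℕ) :
    ∑ i ∈ Finset.Icc 1 n, f i = ∑ i ∈ Finset.range n, f (i + 1) := by
  induction n with
  | zero => simp
  | succ n ih => rw [Finset.sum_Icc_succ_top (by omega), Finset.sum_range_succ, ih]

lemma starTerm_ofSeparators (s : List Bool) : ∃ h t, ofSeparators s = h :: t ∧
    ∀ n, (starTerm s n : ℂ) = 1 / ((n : ℂ) + 1) ^ h * mhss t (n + 1) := by
  induction s with
  | nil => exact ⟨1, [], rfl, fun n => by simp [starTerm, mhss]⟩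
  | cons x s ih =>
    obtain ⟨h, t, hs, hn⟩ := ih
    cases x with
    | false =>
      refine ⟨h + 1, t, by simp [ofSeparators, hs], fun n => ?_⟩
      simp only [starTerm]
      push_cast
      rw [hn, pow_succ]
      have : (n : ℂ) + 1 ≠ 0 := Nat.cast_add_one_ne_zero n
      field_simp
    | true =>
      refine ⟨1, ofSeparators s, rfl, fun n => ?_⟩
      simp only [starTerm]
      push_cast
      rw [hs, mhss, pow_one, div_mul_eq_mul_div, one_mul]
      congr 1
      rw [sum_Icc_one]
      simp only [hn]
      push_cast
      rfl

/-- A leading comma means a leading exponent `1`: this is the factor `1 / n` of the Apéry-type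
series. -/
lemma starTerm_true (s : List Bool) (n : ℕ) :
    (starTerm (true :: s) n : ℂ) = mhss (ofSeparators s) (n + 1) / ((n : ℂ) + 1) := by
  obtain ⟨h, t, hs, hn⟩ := starTerm_ofSeparators (true :: s)
  simp only [ofSeparators, List.cons.injEq] at hs
  rw [hn, ← hs.1, ← hs.2]
  ring

/-! ### Harmonic-number bounds for the star terms. -/

lemma harmonic_nonneg (n : ℕ) : (0 : ℝ) ≤ harmonic n := by
  have : (0 : ℚ) ≤ harmonic n := Finset.sum_nonneg fun i _ => by positivity
  exact_mod_cast this

lemma harmonic_cast_eq (n : ℕ) :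
    ((harmonic n : ℚ) : ℝ) = ∑ i ∈ Finset.range n, 1 / ((i : ℝ) + 1) := by
  simp [harmonic]

lemma harmonic_mono : Monotone fun n => ((harmonic n : ℚ) : ℝ) :=
  monotone_nat_of_le_succ fun n => by
    rw [harmonic_succ]
    push_cast
    have : (0 : ℝ) ≤ ((n : ℝ) + 1)⁻¹ := by positivity
    linarith

lemma one_le_harmonic_succ (n : ℕ) : (1 : ℝ) ≤ harmonic (n + 1) := by
  have := harmonic_mono (Nat.succ_le_succ (Nat.zero_le n))
  simpa [harmonic] using this

lemma starTerm_le (s : List Bool) (n : ℕ) :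
    starTerm s n ≤ (harmonic (n + 1) : ℝ) ^ s.length / ((n : ℝ) + 1) := by
  induction s generalizing n with
  | nil => simp [starTerm]
  | cons x s ih =>
    have hpos : (0 : ℝ) ≤ harmonic (n + 1) := harmonic_nonneg _
    have h1 := one_le_harmonic_succ n
    cases x with
    | false =>
      simp only [starTerm, List.length_cons]
      gcongr
      refine (ih n).trans ((div_le_self (by positivity)
        (by linarith [(Nat.cast_nonneg n : (0 : ℝ) ≤ n)])).trans ?_)
      exact pow_le_pow_right₀ h1 (by omega)
    | true =>
      simp only [starTerm, List.length_cons]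
      gcongr
      rw [pow_succ, harmonic_cast_eq (n + 1), Finset.mul_sum, ← harmonic_cast_eq (n + 1)]
      refine Finset.sum_le_sum fun i hi => (ih i).trans ?_
      rw [div_eq_mul_one_div]
      have : ((harmonic (i + 1) : ℚ) : ℝ) ≤ harmonic (n + 1) :=
        harmonic_mono (Finset.mem_range.mp hi)
      have h0 := harmonic_nonneg (i + 1)
      gcongr

/-! ### The coefficients of `(1 - z) ^ (-α)` -/

/-- The coefficient `α (α + 1) ⋯ (α + n - 1) / n!` of `z ^ n` in `(1 - z) ^ (-α)`. -/
noncomputable def riseRatio (n : ℕ) (α : ℂ) : ℂ :=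
  (∏ i ∈ Finset.range n, (α + i)) / n.factorial

lemma riseRatio_zero (α : ℂ) : riseRatio 0 α = 1 := by simp [riseRatio]

lemma riseRatio_succ (n : ℕ) (α : ℂ) :
    riseRatio (n + 1) α = riseRatio n α * ((α + n) / (n + 1)) := by
  rw [riseRatio, riseRatio, Finset.prod_range_succ, Nat.factorial_succ]
  push_cast
  have h1 : (n : ℂ) + 1 ≠ 0 := Nat.cast_add_one_ne_zero n
  have h2 : (n.factorial : ℂ) ≠ 0 := Nat.cast_ne_zero.mpr n.factorial_ne_zero
  field_simp

lemma riseRatio_succ_sub_one (n : ℕ) (α : ℂ) :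
    riseRatio (n + 1) (α - 1) = (α - 1) / (n + 1) * riseRatio n α := by
  rw [riseRatio, riseRatio, Finset.prod_range_succ', Nat.factorial_succ]
  have h : ∀ i : ℕ, α - 1 + ((i + 1 : ℕ) : ℂ) = α + i := fun i => by push_cast; ring
  simp only [h]
  push_cast
  have h1 : (n : ℂ) + 1 ≠ 0 := Nat.cast_add_one_ne_zero n
  have h2 : (n.factorial : ℂ) ≠ 0 := Nat.cast_ne_zero.mpr n.factorial_ne_zero
  field_simp
  ring

lemma riseRatio_pascal (n : ℕ) (α : ℂ) :
    riseRatio (n + 1) (α - 1) = riseRatio (n + 1) α - riseRatio n α := by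
  rw [riseRatio_succ_sub_one, riseRatio_succ]
  have h1 : (n : ℂ) + 1 ≠ 0 := Nat.cast_add_one_ne_zero n
  field_simp
  ring

lemma riseRatio_succ_zero (n : ℕ) : riseRatio (n + 1) 0 = 0 := by
  have h := riseRatio_succ_sub_one n 1
  simpa using h

lemma differentiable_riseRatio (n : ℕ) : Differentiable ℂ (riseRatio n) := by
  unfold riseRatio
  fun_prop

/-- Expand `‖α + n‖² = (n+1)² + 2(n+1)(Re α - 1) + ‖α - 1‖²`, divide by `(n+1)²` and use `1 + x ≤
exp x`. -/
lemma norm_add_div_le_exp {α : ℂ} {s M : ℝ} (hs : α.re ≤ 1 - s) (hM : ‖α - 1‖ ≤ M) (n : ℕ) :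
    ‖(α + n) / (n + 1)‖ ≤
      Real.exp (-s * (1 / ((n : ℝ) + 1)) + M ^ 2 / 2 * (1 / ((n : ℝ) + 1) ^ 2)) := by
  have hn : (0 : ℝ) < (n : ℝ) + 1 := by positivity
  have hx : 0 ≤ ‖(α + n) / (n + 1)‖ := norm_nonneg _
  refine (sq_le_sq₀ hx (Real.exp_pos _).le).mp ?_
  rw [← Real.exp_nat_mul]
  refine le_trans ?_ (Real.add_one_le_exp _)
  have h1 : ‖(n : ℂ) + 1‖ = (n : ℝ) + 1 := by
    rw [← Nat.cast_add_one, Complex.norm_natCast]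
    push_cast
    rfl
  rw [norm_div, h1, div_pow, div_le_iff₀ (by positivity), Complex.sq_norm, Complex.normSq_apply]
  have h2 : (α.re - 1) * (α.re - 1) + α.im * α.im ≤ M ^ 2 := by
    have := pow_le_pow_left₀ (norm_nonneg _) hM 2
    rw [Complex.sq_norm, Complex.normSq_apply] at this
    simpa using this
  simp only [Complex.add_re, Complex.natCast_re, Complex.add_im, Complex.natCast_im, add_zero]
  have h3 : (((2 : ℕ) : ℝ) * (-s * (1 / ((n : ℝ) + 1)) + M ^ 2 / 2 * (1 / ((n : ℝ) + 1) ^ 2)) + 1) *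
      ((n : ℝ) + 1) ^ 2 = ((n : ℝ) + 1) ^ 2 - 2 * s * (n + 1) + M ^ 2 := by
    push_cast
    field_simp
    ring
  rw [h3]
  nlinarith

/-- In the product of the factor bounds the harmonic sum is at least `log (n+1)`, giving the power,
and the inverse squares are summable, giving `C`. The uniformity in `α` later yields locally uniform
convergence. -/
lemma exists_norm_riseRatio_le {s : ℝ} (hs : 0 ≤ s) (M : ℝ) :
    ∃ C, 0 ≤ C ∧ ∀ α : ℂ, α.re ≤ 1 - s → ‖α - 1‖ ≤ M →
      ∀ n, ‖riseRatio n α‖ ≤ C * ((n : ℝ) + 1) ^ (-s) := by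
  have hsum : Summable fun i : ℕ => 1 / ((i : ℝ) + 1) ^ 2 := by
    have := (summable_nat_add_iff 1).mpr (Real.summable_one_div_nat_pow.mpr one_lt_two)
    simpa using this
  refine ⟨Real.exp (M ^ 2 / 2 * ∑' i : ℕ, 1 / ((i : ℝ) + 1) ^ 2), (Real.exp_pos _).le,
    fun α hα hM n => ?_⟩
  have h1 : ‖riseRatio n α‖ ≤ Real.exp (-s * (harmonic n : ℝ) +
      M ^ 2 / 2 * ∑ i ∈ Finset.range n, 1 / ((i : ℝ) + 1) ^ 2) := by
    rw [harmonic_cast_eq]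
    induction n with
    | zero => simp [riseRatio_zero]
    | succ n ih =>
      rw [riseRatio_succ, norm_mul, Finset.sum_range_succ, Finset.sum_range_succ]
      refine (mul_le_mul ih (norm_add_div_le_exp hα hM n) (norm_nonneg _)
        (Real.exp_pos _).le).trans ?_
      rw [← Real.exp_add]
      exact le_of_eq (congrArg _ (by ring))
  refine h1.trans ?_
  rw [add_comm, Real.exp_add]
  refine mul_le_mul ?_ ?_ (Real.exp_pos _).le (Real.exp_pos _).le
  · gcongr
    exact hsum.sum_le_tsum _ fun i _ => by positivity
  · rw [Real.rpow_def_of_pos (by positivity), Real.exp_le_exp]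
    have := log_add_one_le_harmonic n
    push_cast at this
    nlinarith

lemma exists_harmonic_pow_le (r : ℕ) {ε : ℝ} (hε : 0 < ε) :
    ∃ C, 0 ≤ C ∧ ∀ n : ℕ, (harmonic (n + 1) : ℝ) ^ r ≤ C * ((n : ℝ) + 1) ^ ε := by
  have hr : (0 : ℝ) < r + 1 := by positivity
  -- Dividing by `r + 1` rather than `r` covers `r = 0`.
  set δ := ε / (r + 1) with hδ
  have hδ0 : 0 < δ := by positivity
  refine ⟨(1 + 1 / δ) ^ r, by positivity, fun n => ?_⟩
  have hx : (1 : ℝ) ≤ (n : ℝ) + 1 := by linarith [(Nat.cast_nonneg n : (0 : ℝ) ≤ n)]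
  have h1 : (harmonic (n + 1) : ℝ) ≤ (1 + 1 / δ) * ((n : ℝ) + 1) ^ δ := by
    have h2 := harmonic_le_one_add_log (n + 1)
    have h3 := Real.log_le_rpow_div (x := (n : ℝ) + 1) (by positivity) hδ0
    have h4 := Real.one_le_rpow hx hδ0.le
    push_cast at h2
    calc (harmonic (n + 1) : ℝ) ≤ ((n : ℝ) + 1) ^ δ + ((n : ℝ) + 1) ^ δ / δ := by linarith
      _ = _ := by ring
  refine (pow_le_pow_left₀ (harmonic_nonneg _) h1 r).trans ?_
  rw [mul_pow, ← Real.rpow_natCast (((n : ℝ) + 1) ^ δ), ← Real.rpow_mul (by positivity)]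
  have hδr : δ * r ≤ ε := by
    rw [hδ, div_mul_eq_mul_div, div_le_iff₀ hr]
    nlinarith
  have := Real.rpow_le_rpow_of_exponent_le hx hδr
  gcongr

lemma summable_rpow_mul_harmonic_pow {s : ℝ} (hs : 0 < s) (r : ℕ) :
    Summable fun n : ℕ =>
      ((n : ℝ) + 1) ^ (-s) * ((harmonic (n + 1) : ℝ) ^ r / ((n : ℝ) + 1)) := by
  obtain ⟨C, hC, h⟩ := exists_harmonic_pow_le r (half_pos hs)
  have h1 : Summable fun n : ℕ => C * ((n : ℝ) + 1) ^ (-1 - s / 2) := by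
    refine Summable.mul_left C ?_
    have := (summable_nat_add_iff 1).mpr
      (Real.summable_nat_rpow.mpr (show -1 - s / 2 < -1 by linarith))
    simpa using this
  refine Summable.of_nonneg_of_le (fun n => ?_) (fun n => ?_) h1
  · have := harmonic_nonneg (n + 1)
    positivity
  · have hx : (0 : ℝ) < (n : ℝ) + 1 := by positivity
    calc ((n : ℝ) + 1) ^ (-s) * ((harmonic (n + 1) : ℝ) ^ r / ((n : ℝ) + 1))
        ≤ ((n : ℝ) + 1) ^ (-s) * (C * ((n : ℝ) + 1) ^ (s / 2) / ((n : ℝ) + 1)) := by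
          gcongr
          exact h n
      _ = C * (((n : ℝ) + 1) ^ (-s) * ((n : ℝ) + 1) ^ (s / 2) * ((n : ℝ) + 1) ^ (-1 : ℝ)) := by
          rw [Real.rpow_neg_one]
          ring
      _ = C * ((n : ℝ) + 1) ^ (-1 - s / 2) := by
          rw [← Real.rpow_add hx, ← Real.rpow_add hx]
          ring_nf

lemma tendsto_rpow_mul_harmonic_pow {s : ℝ} (hs : 0 < s) (r : ℕ) :
    Tendsto (fun n : ℕ => ((n : ℝ) + 1) ^ (-s) * (harmonic (n + 1) : ℝ) ^ r) atTop (𝓝 0) := by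
  obtain ⟨C, hC, h⟩ := exists_harmonic_pow_le r (half_pos hs)
  have h1 : Tendsto (fun n : ℕ => C * ((n : ℝ) + 1) ^ (-(s / 2))) atTop (𝓝 0) := by
    have h2 := (tendsto_rpow_neg_atTop (half_pos hs)).comp
      (tendsto_atTop_add_const_right _ (1 : ℝ) tendsto_natCast_atTop_atTop)
    simpa using h2.const_mul C
  refine squeeze_zero (fun n => ?_) (fun n => ?_) h1
  · have := harmonic_nonneg (n + 1)
    positivity
  · have hx : (0 : ℝ) < (n : ℝ) + 1 := by positivity
    calc ((n : ℝ) + 1) ^ (-s) * (harmonic (n + 1) : ℝ) ^ r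
        ≤ ((n : ℝ) + 1) ^ (-s) * (C * ((n : ℝ) + 1) ^ (s / 2)) := by
          gcongr
          exact h n
      _ = C * (((n : ℝ) + 1) ^ (-s) * ((n : ℝ) + 1) ^ (s / 2)) := by ring
      _ = C * ((n : ℝ) + 1) ^ (-(s / 2)) := by
          rw [← Real.rpow_add hx]
          ring_nf

/-- A summable bound for the terms `riseRatio (n + 1) α * starTerm s n`, uniform in `α`. -/
lemma exists_summable_bound {s : ℝ} (hs : 0 < s) (M : ℝ) (w : List Bool) :
    ∃ u : ℕ → ℝ, Summable u ∧ ∀ α : ℂ, α.re ≤ 1 - s → ‖α - 1‖ ≤ M →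
      ∀ n, ‖riseRatio n α‖ * starTerm w n ≤ u n ∧ ‖riseRatio (n + 1) α‖ * starTerm w n ≤ u n := by
  obtain ⟨C, hC, h⟩ := exists_norm_riseRatio_le hs.le M
  refine ⟨_, (summable_rpow_mul_harmonic_pow hs w.length).mul_left C, fun α hα hM n => ?_⟩
  have h1 : ‖riseRatio (n + 1) α‖ ≤ C * ((n : ℝ) + 1) ^ (-s) := by
    refine (h α hα hM (n + 1)).trans ?_
    push_cast
    refine mul_le_mul_of_nonneg_left ?_ hC
    exact Real.rpow_le_rpow_of_nonpos (by positivity) (by linarith) (by linarith)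
  rw [← mul_assoc]
  have h2 := starTerm_nonneg w n
  exact ⟨mul_le_mul (h α hα hM n) (starTerm_le w n) h2 (by positivity),
    mul_le_mul h1 (starTerm_le w n) h2 (by positivity)⟩

/-! ### Newton series with the coefficients `starTerm` -/

/-- The series `∑_{n ≥ 1} (α)_n / n! · e (n - 1)`. -/
noncomputable def newtonSum (e : ℕ → ℝ) (α : ℂ) : ℂ := ∑' n, riseRatio (n + 1) α * (e n : ℂ)

lemma summable_riseRatio {α : ℂ} (hα : α.re < 1) {w : List Bool} {e : ℕ → ℝ}
    (he : ∀ n, |e n| ≤ starTerm w n) :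
    Summable (fun n => riseRatio n α * (e n : ℂ)) ∧
      Summable (fun n => riseRatio (n + 1) α * (e n : ℂ)) := by
  obtain ⟨u, hu, h⟩ := exists_summable_bound (sub_pos.mpr hα) ‖α - 1‖ w
  have h' := h α (by linarith) le_rfl
  have key : ∀ (z : ℂ) n, ‖z * (e n : ℂ)‖ ≤ ‖z‖ * starTerm w n := fun z n => by
    rw [norm_mul, Complex.norm_real, Real.norm_eq_abs]
    gcongr
    exact he n
  exact ⟨Summable.of_norm_bounded hu fun n => (key _ n).trans (h' n).1,
    Summable.of_norm_bounded hu fun n => (key _ n).trans (h' n).2⟩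

lemma abs_iterDiff_starTerm_le (w : List Bool) (N n : ℕ) :
    |iterDiff (starTerm w) N n| ≤ starTerm w n := by
  have h := (completelyMonotone_starTerm w).nonneg
  rw [abs_of_nonneg (h N n)]
  exact iterDiff_le_of_nonneg h N n

lemma abs_starTerm_le (w : List Bool) (n : ℕ) : |starTerm w n| ≤ starTerm w n :=
  (abs_of_nonneg (starTerm_nonneg w n)).le

lemma re_sub_one_lt {α : ℂ} (hα : α.re < 1) : (α - 1).re < 1 := by
  rw [Complex.sub_re, Complex.one_re]
  linarith

/-- Pascal's rule for the coefficients turns the shift of `α` into a summation by parts; the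
subtracted term is the boundary at `n = 0`. -/
lemma newtonSum_iterDiff_sub_one {α : ℂ} (hα : α.re < 1) (w : List Bool) (N : ℕ) :
    newtonSum (iterDiff (starTerm w) N) (α - 1) =
      newtonSum (iterDiff (starTerm w) (N + 1)) α - iterDiff (starTerm w) N 0 := by
  obtain ⟨h1, h2⟩ := summable_riseRatio hα (abs_iterDiff_starTerm_le w N)
  obtain ⟨-, h3⟩ := summable_riseRatio hα (abs_iterDiff_starTerm_le w (N + 1))
  have h4 := h1.tsum_eq_zero_add
  have h5 := (summable_nat_add_iff 1).mpr h1
  have h6 : newtonSum (iterDiff (starTerm w) N) (α - 1) =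
      (∑' n, riseRatio (n + 1) α * (iterDiff (starTerm w) N n : ℂ)) -
        ∑' n, riseRatio n α * (iterDiff (starTerm w) N n : ℂ) := by
    rw [newtonSum, ← h2.tsum_sub h1]
    refine tsum_congr fun n => ?_
    rw [riseRatio_pascal]
    ring
  have h7 : newtonSum (iterDiff (starTerm w) (N + 1)) α =
      (∑' n, riseRatio (n + 1) α * (iterDiff (starTerm w) N n : ℂ)) -
        ∑' n, riseRatio (n + 1) α * (iterDiff (starTerm w) N (n + 1) : ℂ) := by
    rw [newtonSum, ← h2.tsum_sub h5]
    refine tsum_congr fun n => ?_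
    rw [iterDiff]
    push_cast
    ring
  rw [h6, h7, h4, riseRatio_zero]
  ring

lemma newtonSum_sub_natCast (w : List Bool) (N : ℕ) {α : ℂ} (hα : α.re < 1) :
    newtonSum (starTerm w) (α - N) = newtonSum (iterDiff (starTerm w) N) α -
      ∑ i ∈ Finset.range N, (iterDiff (starTerm w) i 0 : ℂ) := by
  induction N generalizing α with
  | zero => simp [show iterDiff (starTerm w) 0 = starTerm w from rfl]
  | succ N ih =>
    have h := ih (re_sub_one_lt hα)
    rw [newtonSum_iterDiff_sub_one hα] at h
    rw [Finset.sum_range_succ, Nat.cast_succ, show α - ((N : ℂ) + 1) = α - 1 - N by ring, h]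
    ring

lemma newtonSum_zero (e : ℕ → ℝ) : newtonSum e 0 = 0 := by
  simp [newtonSum, riseRatio_succ_zero]

lemma tendsto_newtonSum_iterDiff {α : ℂ} (hα : α.re < 1) (w : List Bool) :
    Tendsto (fun N => newtonSum (iterDiff (starTerm w) N) α) atTop (𝓝 0) := by
  obtain ⟨u, hu, h⟩ := exists_summable_bound (sub_pos.mpr hα) ‖α - 1‖ w
  have h' := h α (by linarith) le_rfl
  have key := tendsto_tsum_of_dominated_convergence (𝓕 := atTop)
    (f := fun N n => riseRatio (n + 1) α * (iterDiff (starTerm w) N n : ℂ)) (g := fun _ => 0) hu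
    (fun n => by
      have := (Complex.continuous_ofReal.tendsto 0).comp
        ((completelyMonotone_starTerm w).tendsto n)
      simpa using this.const_mul (riseRatio (n + 1) α))
    (Eventually.of_forall fun N n => by
      rw [norm_mul, Complex.norm_real, Real.norm_eq_abs]
      refine le_trans ?_ (h' n).2
      gcongr
      exact abs_iterDiff_starTerm_le w N n)
  simpa [newtonSum] using key

/-- Each of the two values may diverge (like `ζ⋆_N` with leading exponent `1`), but their divergent
parts do not depend on `α` and cancel. -/
lemma tendsto_newtonSum_sub {α : ℂ} (hα : α.re < 1) (w : List Bool) :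
    Tendsto (fun N : ℕ => newtonSum (starTerm w) (α - N) - newtonSum (starTerm w) (0 - N))
      atTop (𝓝 0) := by
  refine (tendsto_newtonSum_iterDiff hα w).congr fun N => ?_
  rw [newtonSum_sub_natCast w N hα, newtonSum_sub_natCast w N (by simp), newtonSum_zero]
  ring

/-- The backward difference of `newtonSum (starTerm w)`. -/
noncomputable def newtonDiff (w : List Bool) (α : ℂ) : ℂ := ∑' n, riseRatio n α * (starTerm w n : ℂ)

lemma newtonSum_sub_newtonSum_sub_one {α : ℂ} (hα : α.re < 1) (w : List Bool) :
    newtonSum (starTerm w) α - newtonSum (starTerm w) (α - 1) = newtonDiff w α := by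
  obtain ⟨h1, h2⟩ := summable_riseRatio hα (abs_starTerm_le w)
  have h3 := (summable_riseRatio (re_sub_one_lt hα) (abs_starTerm_le w)).2
  rw [newtonSum, newtonSum, newtonDiff, ← h2.tsum_sub h3]
  refine tsum_congr fun n => ?_
  rw [riseRatio_pascal]
  ring

lemma one_sub_mul_riseRatio (n : ℕ) (α : ℂ) :
    (1 - α) * (riseRatio n α / ((n : ℂ) + 1)) = -riseRatio (n + 1) (α - 1) := by
  rw [riseRatio_succ_sub_one]
  ring

lemma one_sub_mul_newtonDiff_false (α : ℂ) (w : List Bool) :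
    (1 - α) * newtonDiff (false :: w) α = -newtonSum (starTerm w) (α - 1) := by
  rw [newtonDiff, newtonSum, ← tsum_mul_left, ← tsum_neg]
  refine tsum_congr fun n => ?_
  rw [← neg_mul, ← one_sub_mul_riseRatio]
  simp only [starTerm]
  push_cast
  ring

lemma tendsto_riseRatio_mul_harmonic_pow {α : ℂ} (hα : α.re < 1) (r : ℕ) :
    Tendsto (fun n => ‖riseRatio n α‖ * (harmonic (n + 1) : ℝ) ^ r) atTop (𝓝 0) := by
  obtain ⟨C, hC, h⟩ := exists_norm_riseRatio_le (sub_pos.mpr hα).le ‖α - 1‖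
  have h1 := (tendsto_rpow_mul_harmonic_pow (sub_pos.mpr hα) r).const_mul C
  rw [mul_zero] at h1
  refine squeeze_zero (fun n => ?_) (fun n => ?_) h1
  · have := harmonic_nonneg (n + 1)
    positivity
  · rw [← mul_assoc]
    have := harmonic_nonneg (n + 1)
    gcongr
    exact h α (by linarith) le_rfl n

/-- The partial sums telescope to `1 - riseRatio N α`. -/
lemma newtonDiff_nil {α : ℂ} (hα : α.re < 1) : (1 - α) * newtonDiff [] α = 1 := by
  have h1 := ((summable_riseRatio hα (abs_starTerm_le [])).1.mul_left (1 - α)).hasSum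
  rw [newtonDiff, ← tsum_mul_left]
  refine tendsto_nhds_unique h1.tendsto_sum_nat ?_
  have h2 : ∀ N, ∑ n ∈ Finset.range N, (1 - α) * (riseRatio n α * (starTerm [] n : ℂ)) =
      1 - riseRatio N α := by
    intro N
    induction N with
    | zero => simp [riseRatio_zero]
    | succ N ih =>
      have h3 := one_sub_mul_riseRatio N α
      rw [riseRatio_pascal] at h3
      rw [Finset.sum_range_succ, ih]
      simp only [starTerm]
      push_cast
      linear_combination h3
  simp only [h2]
  have h4 := tendsto_riseRatio_mul_harmonic_pow hα 0
  simp only [pow_zero, mul_one] at h4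
  simpa using (tendsto_zero_iff_norm_tendsto_zero.mpr h4).const_sub 1

lemma sum_starTerm_le (w : List Bool) (n : ℕ) :
    ∑ i ∈ Finset.range n, starTerm w i ≤ (harmonic (n + 1) : ℝ) ^ (w.length + 1) := by
  have h1 := starTerm_le (true :: w) n
  simp only [starTerm, List.length_cons] at h1
  have h2 := (div_le_div_iff_of_pos_right (by positivity)).mp h1
  rw [Finset.sum_range_succ] at h2
  linarith [starTerm_nonneg w n]

/-- Abel summation: the boundary term vanishes because power decay of `riseRatio` beats the
logarithmic growth of the partial sums. -/
lemma one_sub_mul_newtonDiff_true {α : ℂ} (hα : α.re < 1) (w : List Bool) :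
    (1 - α) * newtonDiff (true :: w) α = newtonDiff w α := by
  have h1 := ((summable_riseRatio hα (abs_starTerm_le (true :: w))).1.mul_left (1 - α)).hasSum
  have h2 := (summable_riseRatio hα (abs_starTerm_le w)).1.hasSum.tendsto_sum_nat
  rw [newtonDiff, ← tsum_mul_left]
  refine tendsto_nhds_unique h1.tendsto_sum_nat ?_
  set S : ℕ → ℂ := fun n => ∑ i ∈ Finset.range n, (starTerm w i : ℂ) with hS
  have h3 : ∀ N, ∑ n ∈ Finset.range N, (1 - α) * (riseRatio n α * (starTerm (true :: w) n : ℂ)) =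
      ∑ n ∈ Finset.range N, riseRatio n α * (starTerm w n : ℂ) - riseRatio N α * S N := by
    intro N
    induction N with
    | zero => simp [hS]
    | succ N ih =>
      have h3 := one_sub_mul_riseRatio N α
      rw [riseRatio_pascal] at h3
      have h4 : (starTerm (true :: w) N : ℂ) = S (N + 1) / ((N : ℂ) + 1) := by
        simp only [starTerm, hS]
        push_cast
        rfl
      have h5 : S (N + 1) = S N + starTerm w N := Finset.sum_range_succ _ _
      rw [Finset.sum_range_succ, Finset.sum_range_succ, ih, h4]
      linear_combination S (N + 1) * h3 + riseRatio N α * h5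
  simp only [h3]
  have h4 : Tendsto (fun N => riseRatio N α * S N) atTop (𝓝 0) := by
    refine squeeze_zero_norm (fun N => ?_)
      (tendsto_riseRatio_mul_harmonic_pow hα (w.length + 1))
    rw [norm_mul]
    refine mul_le_mul_of_nonneg_left ?_ (norm_nonneg _)
    refine le_trans (le_of_eq ?_) (sum_starTerm_le w N)
    rw [hS]
    simp only
    rw [← Complex.ofReal_sum, Complex.norm_real, Real.norm_eq_abs,
      abs_of_nonneg (Finset.sum_nonneg fun i _ => starTerm_nonneg w i)]
  simpa [newtonDiff] using h2.sub h4

/-- Interpolation of the finite multiple harmonic star sum: at `α = -N` this is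
`ζ⋆_N(k₁, …, k_r)`. -/
noncomputable def starInterp : List ℕ → ℂ → ℂ
  | [], _ => 1
  | k :: ks, α => -newtonSum (starTerm ((separators (k :: ks)).map not)) α

lemma newtonDiff_replicate {α : ℂ} (hα : α.re < 1) (n : ℕ) (w : List Bool) :
    (1 - α) ^ n * newtonDiff (List.replicate n true ++ w) α = newtonDiff w α := by
  induction n with
  | zero => simp
  | succ n ih =>
    rw [pow_succ, List.replicate_succ, List.cons_append, mul_assoc,
      one_sub_mul_newtonDiff_true hα, ih]

lemma one_sub_ne_zero {α : ℂ} (hα : α.re < 1) : 1 - α ≠ 0 := fun h => by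
  have := congrArg Complex.re h
  simp at this
  linarith

/-- After complementing, a part `k` begins with `k - 1` letters `true`, each worth one factor `1 /
(1 - α)`. The last factor comes from the end of the word or from the following `false`, which also
moves the tail to `α - 1`. -/
lemma starInterp_cons_sub_one {α : ℂ} (hα : α.re < 1) {k : ℕ} (hk : 1 ≤ k) (ks : List ℕ) :
    starInterp (k :: ks) (α - 1) - starInterp (k :: ks) α =
      1 / (1 - α) ^ k * starInterp ks (α - 1) := by
  have h0 := one_sub_ne_zero hα
  obtain ⟨j, rfl⟩ : ∃ j, k = j + 1 := ⟨k - 1, by omega⟩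
  simp only [starInterp]
  rw [neg_sub_neg, newtonSum_sub_newtonSum_sub_one hα, one_div, eq_inv_mul_iff_mul_eq₀
    (pow_ne_zero _ h0), pow_succ']
  cases ks with
  | nil =>
    have := newtonDiff_replicate hα j []
    simp only [List.append_nil] at this
    simp only [separators, List.map_replicate, Bool.not_false, Nat.add_sub_cancel]
    rw [mul_assoc, this, newtonDiff_nil hα]
  | cons k' ks =>
    simp only [separators, List.map_replicate, Bool.not_false, Nat.add_sub_cancel,
      List.map_append, List.map_cons, Bool.not_true]
    rw [mul_assoc, newtonDiff_replicate hα, one_sub_mul_newtonDiff_false]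

lemma starInterp_nil (α : ℂ) : starInterp [] α = 1 := rfl

lemma starInterp_cons_zero (k : ℕ) (ks : List ℕ) : starInterp (k :: ks) 0 = 0 := by
  simp [starInterp, newtonSum_zero]

lemma tendsto_starInterp_sub {α : ℂ} (hα : α.re < 1) (l : List ℕ) :
    Tendsto (fun N : ℕ => starInterp l (α - N) - starInterp l (0 - N)) atTop (𝓝 0) := by
  cases l with
  | nil => simp [starInterp]
  | cons k ks =>
    have := (tendsto_newtonSum_sub hα ((separators (k :: ks)).map not)).neg
    rw [neg_zero] at this
    refine this.congr fun N => ?_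
    simp only [starInterp]
    ring

/-! ### Convergence of multiple harmonic sums -/

/-- The real multiple harmonic sum `ζ_n(k₁, …, k_r; 1)`. -/
noncomputable def realMhs : List ℕ → ℕ → ℝ
  | [], _ => 1
  | k :: ks, n => ∑ i ∈ Finset.range n, 1 / ((i : ℝ) + 1) ^ k * realMhs ks i

lemma realMhs_nonneg (l : List ℕ) (n : ℕ) : 0 ≤ realMhs l n := by
  induction l generalizing n with
  | nil => simp [realMhs]
  | cons k ks ih => exact Finset.sum_nonneg fun i _ => mul_nonneg (by positivity) (ih i)

lemma realMhs_le (l : List ℕ) (hl : ∀ k ∈ l, 1 ≤ k) (n : ℕ) :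
    realMhs l n ≤ (harmonic n : ℝ) ^ l.length := by
  induction l generalizing n with
  | nil => simp [realMhs]
  | cons k ks ih =>
    rw [List.length_cons, pow_succ, harmonic_cast_eq n, Finset.mul_sum, ← harmonic_cast_eq n]
    refine Finset.sum_le_sum fun i hi => ?_
    rw [mul_comm]
    have h1 := ih (fun k hk => hl k (List.mem_cons_of_mem _ hk)) i
    have h2 : ((harmonic i : ℚ) : ℝ) ≤ harmonic n := harmonic_mono (Finset.mem_range.mp hi).le
    have h3 := harmonic_nonneg i
    have h4 : ((i : ℝ) + 1) ≤ ((i : ℝ) + 1) ^ k :=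
      le_self_pow₀ (by linarith [(Nat.cast_nonneg i : (0 : ℝ) ≤ i)])
        (Nat.one_le_iff_ne_zero.mp (hl k List.mem_cons_self))
    have h5 := realMhs_nonneg ks i
    refine mul_le_mul (h1.trans (pow_le_pow_left₀ h3 h2 _)) ?_ (by positivity)
      (pow_nonneg (harmonic_nonneg n) _)
    exact one_div_le_one_div_of_le (by positivity) h4

lemma mhs_cons_one_sub (k : ℕ) (ks : List ℕ) (α : ℂ) (n : ℕ) :
    mhs (k :: ks) (1 - α) n =
      ∑ i ∈ Finset.range n, 1 / ((i : ℂ) + 1 - α) ^ k * mhs ks (1 - α) i := by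
  rw [mhs, sum_Icc_one]
  refine Finset.sum_congr rfl fun i _ => ?_
  rw [Nat.add_sub_cancel]
  push_cast
  ring_nf

lemma norm_mhs_le {α : ℂ} {C : ℝ} (h : ∀ n : ℕ, ‖((n : ℂ) + 1 - α)⁻¹‖ ≤ C / ((n : ℝ) + 1))
    (l : List ℕ) (n : ℕ) : ‖mhs l (1 - α) n‖ ≤ C ^ l.sum * realMhs l n := by
  have hC : 0 ≤ C := by
    have := (norm_nonneg _).trans (h 0)
    simpa using this
  induction l generalizing n with
  | nil => simp [mhs, realMhs]
  | cons k ks ih =>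
    rw [mhs_cons_one_sub, realMhs, Finset.mul_sum]
    refine norm_sum_le_of_le _ fun i _ => ?_
    rw [norm_mul, one_div, ← inv_pow, norm_pow, List.sum_cons, pow_add]
    have h1 := pow_le_pow_left₀ (norm_nonneg _) (h i) k
    calc _ ≤ (C / ((i : ℝ) + 1)) ^ k * (C ^ ks.sum * realMhs ks i) := by
          gcongr
          exact ih i
      _ = _ := by rw [div_pow]; ring

/-- Positive entries, and the first one at least `2`: the condition for convergence. -/
def Admissible (l : List ℕ) : Prop := (∀ k ∈ l, 1 ≤ k) ∧ ∀ k ∈ l.head?, 2 ≤ k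

lemma norm_mhs_term_le {α : ℂ} {C : ℝ} (h : ∀ n : ℕ, ‖((n : ℂ) + 1 - α)⁻¹‖ ≤ C / ((n : ℝ) + 1))
    {k : ℕ} {ks : List ℕ} (hl : Admissible (k :: ks)) (n : ℕ) :
    ‖1 / ((n : ℂ) + 1 - α) ^ k * mhs ks (1 - α) n‖ ≤ C ^ (k + ks.sum) *
      (((n : ℝ) + 1) ^ (-(1 : ℝ)) * ((harmonic (n + 1) : ℝ) ^ ks.length / ((n : ℝ) + 1))) := by
  have hC : 0 ≤ C := by
    have := (norm_nonneg _).trans (h 0)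
    simpa using this
  have hn : (1 : ℝ) ≤ (n : ℝ) + 1 := by linarith [(Nat.cast_nonneg n : (0 : ℝ) ≤ n)]
  have hn0 : (0 : ℝ) < (n : ℝ) + 1 := by positivity
  rw [norm_mul, one_div, ← inv_pow, norm_pow, pow_add, Real.rpow_neg_one]
  have h1 := pow_le_pow_left₀ (norm_nonneg _) (h n) k
  have h2 := (norm_mhs_le h ks n).trans (mul_le_mul_of_nonneg_left
    ((realMhs_le ks (fun k hk => hl.1 k (List.mem_cons_of_mem _ hk)) n).trans
      (pow_le_pow_left₀ (harmonic_nonneg n) (harmonic_mono n.le_succ) _)) (by positivity))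
  have h3 : (C / ((n : ℝ) + 1)) ^ k ≤ C ^ k * (((n : ℝ) + 1)⁻¹ * ((n : ℝ) + 1)⁻¹) := by
    rw [div_pow, div_eq_mul_inv]
    refine mul_le_mul_of_nonneg_left ?_ (by positivity)
    rw [← mul_inv, ← sq]
    exact inv_anti₀ (by positivity) (pow_le_pow_right₀ hn (hl.2 k (by simp)))
  refine (mul_le_mul (h1.trans h3) h2 (norm_nonneg _) (by positivity)).trans (le_of_eq ?_)
  rw [Nat.succ_eq_add_one]
  ring

lemma summable_mhs_bound (C : ℝ) (r : ℕ) : Summable fun n : ℕ => C *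
    (((n : ℝ) + 1) ^ (-(1 : ℝ)) * ((harmonic (n + 1) : ℝ) ^ r / ((n : ℝ) + 1))) :=
  (summable_rpow_mul_harmonic_pow one_pos r).mul_left C

lemma tendstoUniformlyOn_mhs_tsum {S : Set ℂ} {C : ℝ}
    (h : ∀ α ∈ S, ∀ n : ℕ, ‖((n : ℂ) + 1 - α)⁻¹‖ ≤ C / ((n : ℝ) + 1)) {k : ℕ} {ks : List ℕ}
    (hl : Admissible (k :: ks)) :
    TendstoUniformlyOn (fun n α => mhs (k :: ks) (1 - α) n)
      (fun α => ∑' n : ℕ, 1 / ((n : ℂ) + 1 - α) ^ k * mhs ks (1 - α) n) atTop S := by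
  have := tendstoUniformlyOn_tsum_nat (summable_mhs_bound (C ^ (k + ks.sum)) ks.length) (s := S)
    (f := fun (n : ℕ) α => 1 / ((n : ℂ) + 1 - α) ^ k * mhs ks (1 - α) n)
    (fun n α hα => norm_mhs_term_le (h α hα) hl n)
  simpa only [mhs_cons_one_sub] using this

lemma hmzv_cons_eq_tsum {α : ℂ} {C : ℝ}
    (h : ∀ n : ℕ, ‖((n : ℂ) + 1 - α)⁻¹‖ ≤ C / ((n : ℝ) + 1)) {k : ℕ} {ks : List ℕ}
    (hl : Admissible (k :: ks)) :
    hmzv (k :: ks) (1 - α) = ∑' n : ℕ, 1 / ((n : ℂ) + 1 - α) ^ k * mhs ks (1 - α) n :=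
  ((tendstoUniformlyOn_mhs_tsum (S := {α}) (by simpa using h) hl).tendsto_at
    (Set.mem_singleton α)).limUnder_eq

lemma hmzv_nil (a : ℂ) : hmzv [] a = 1 :=
  Tendsto.limUnder_eq (by simp [show mhs [] a = fun _ => 1 from rfl])

lemma tendstoUniformlyOn_mhs {S : Set ℂ} {C : ℝ}
    (h : ∀ α ∈ S, ∀ n : ℕ, ‖((n : ℂ) + 1 - α)⁻¹‖ ≤ C / ((n : ℝ) + 1)) {l : List ℕ}
    (hl : Admissible l) :
    TendstoUniformlyOn (fun n α => mhs l (1 - α) n) (fun α => hmzv l (1 - α)) atTop S := by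
  cases l with
  | nil =>
    simp only [hmzv_nil, mhs]
    exact fun u hu => Eventually.of_forall fun _ _ _ => refl_mem_uniformity hu
  | cons k ks =>
    exact (tendstoUniformlyOn_mhs_tsum h hl).congr_right fun α hα =>
      (hmzv_cons_eq_tsum (h α hα) hl).symm

lemma norm_inv_le_of_re_le {α : ℂ} {s : ℝ} (hs : 0 < s) (hs1 : s ≤ 1) (hα : α.re ≤ 1 - s) (n : ℕ) :
    ‖((n : ℂ) + 1 - α)⁻¹‖ ≤ (1 / s) / ((n : ℝ) + 1) := by
  have h1 := Complex.re_le_norm ((n : ℂ) + 1 - α)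
  simp only [Complex.sub_re, Complex.add_re, Complex.natCast_re, Complex.one_re] at h1
  have hn : (0 : ℝ) ≤ n := Nat.cast_nonneg n
  rw [norm_inv, div_div, ← one_div]
  refine one_div_le_one_div_of_le (by positivity) ?_
  nlinarith

/-- The ratios converge, hence are bounded. If `α` is a positive integer, the one singular term is
`0⁻¹ = 0`, so no value of `α` needs to be excluded. -/
lemma exists_norm_inv_le (α : ℂ) :
    ∃ C : ℝ, ∀ n : ℕ, ‖((n : ℂ) + 1 - α)⁻¹‖ ≤ C / ((n : ℝ) + 1) := by
  have h1 : Tendsto (fun n : ℕ => ‖(1 - α * ((n : ℂ) + 1)⁻¹)⁻¹‖) atTop (𝓝 ‖(1 - α * 0)⁻¹‖) := by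
    have h2 : Tendsto (fun n : ℕ => ((n : ℂ) + 1)⁻¹) atTop (𝓝 0) := by
      simpa using tendsto_one_div_add_atTop_nhds_zero_nat (𝕜 := ℂ)
    exact (((h2.const_mul α).const_sub 1).inv₀ (by simp)).norm
  obtain ⟨C, hC⟩ := h1.bddAbove_range
  refine ⟨C, fun n => ?_⟩
  have h3 := hC ⟨n, rfl⟩
  simp only at h3
  have h4 : (n : ℂ) + 1 ≠ 0 := Nat.cast_add_one_ne_zero n
  have h5 : ‖(n : ℂ) + 1‖ = (n : ℝ) + 1 := by
    rw [← Nat.cast_add_one, Complex.norm_natCast]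
    push_cast
    rfl
  rw [le_div_iff₀ (by positivity), ← h5, ← norm_mul]
  convert h3 using 2
  rw [show 1 - α * ((n : ℂ) + 1)⁻¹ = ((n : ℂ) + 1 - α) * ((n : ℂ) + 1)⁻¹ by field_simp, mul_inv,
    inv_inv]

lemma tendsto_mhs (α : ℂ) {l : List ℕ} (hl : Admissible l) :
    Tendsto (mhs l (1 - α)) atTop (𝓝 (hmzv l (1 - α))) := by
  obtain ⟨C, hC⟩ := exists_norm_inv_le α
  exact (tendstoUniformlyOn_mhs (S := {α}) (by simpa using hC) hl).tendsto_at
    (Set.mem_singleton α)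

lemma mhs_append_singleton_zero (K : List ℕ) (m : ℕ) (a : ℂ) : mhs (K ++ [m]) a 0 = 0 := by
  cases K <;> simp [mhs]

/-- Split according to whether the smallest summation variable equals `1`, then shift all larger
variables by one. -/
lemma mhs_append_singleton_succ (K : List ℕ) (m : ℕ) (α : ℂ) (n : ℕ) :
    mhs (K ++ [m]) (1 - α) (n + 1) = mhs (K ++ [m]) (1 - (α - 1)) n +
      1 / (1 - α) ^ m * mhs K (1 - (α - 1)) n := by
  have h (i : ℕ) : ((i + 1 : ℕ) : ℂ) + 1 - α = (i : ℂ) + 1 - (α - 1) := by push_cast; ring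
  induction K generalizing n with
  | nil =>
    rw [List.nil_append, mhs_cons_one_sub, mhs_cons_one_sub, Finset.sum_range_succ']
    simp only [mhs, h]
    simp
  | cons k K ih =>
    rw [List.cons_append, mhs_cons_one_sub, mhs_cons_one_sub, mhs_cons_one_sub,
      Finset.sum_range_succ', mhs_append_singleton_zero, mul_zero, add_zero, Finset.mul_sum,
      ← Finset.sum_add_distrib]
    refine Finset.sum_congr rfl fun i _ => ?_
    rw [ih, h]
    ring

lemma Admissible.of_append_singleton {K : List ℕ} {m : ℕ} (h : Admissible (K ++ [m])) :
    Admissible K := by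
  refine ⟨fun k hk => h.1 k (by simp [hk]), fun k hk => h.2 k ?_⟩
  cases K with
  | nil => simp at hk
  | cons a K => simpa using hk

lemma hmzv_append_singleton {K : List ℕ} {m : ℕ} (h : Admissible (K ++ [m])) (α : ℂ) :
    hmzv (K ++ [m]) (1 - α) = hmzv (K ++ [m]) (1 - (α - 1)) +
      1 / (1 - α) ^ m * hmzv K (1 - (α - 1)) := by
  have h1 := (tendsto_mhs α h).comp (tendsto_add_atTop_nat 1)
  have h2 := (tendsto_mhs (α - 1) h).add ((tendsto_mhs (α - 1) h.of_append_singleton).const_mul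
    (1 / (1 - α) ^ m))
  exact tendsto_nhds_unique h1 (h2.congr fun n => (mhs_append_singleton_succ K m α n).symm)

lemma tendsto_hmzv_sub_natCast {l : List ℕ} (hl : Admissible l) (h0 : l ≠ []) {α : ℂ}
    (hα : α.re < 1) : Tendsto (fun N : ℕ => hmzv l (1 - (α - N))) atTop (𝓝 0) := by
  obtain ⟨k, ks, rfl⟩ := List.exists_cons_of_ne_nil h0
  have hre : ∀ N n : ℕ, (n : ℝ) + N ≤ ‖(n : ℂ) + 1 - (α - N)‖ := fun N n => by
    have h1 := Complex.re_le_norm ((n : ℂ) + 1 - (α - N))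
    simp only [Complex.sub_re, Complex.add_re, Complex.natCast_re, Complex.one_re] at h1
    linarith
  -- For `N ≥ 1` the constant is `1` for all `N`, which provides a dominating series independent of
  -- `N`.
  have hb : ∀ N : ℕ, 1 ≤ N → ∀ n : ℕ, ‖((n : ℂ) + 1 - (α - N))⁻¹‖ ≤ 1 / ((n : ℝ) + 1) :=
    fun N hN n => by
      have hN' : (1 : ℝ) ≤ N := by exact_mod_cast hN
      rw [norm_inv, ← one_div]
      exact one_div_le_one_div_of_le (by positivity) (by linarith [hre N n])
  have key := tendsto_tsum_of_dominated_convergence (𝓕 := atTop)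
    (f := fun (N n : ℕ) => 1 / ((n : ℂ) + 1 - (α - N)) ^ k * mhs ks (1 - (α - N)) n)
    (g := fun _ => 0) (summable_mhs_bound (1 ^ (k + ks.sum)) ks.length)
    (fun n => by
      have h2 := (tendsto_one_div_atTop_nhds_zero_nat (𝕜 := ℝ)).mul_const (realMhs ks n)
      rw [zero_mul] at h2
      refine squeeze_zero_norm' ?_ h2
      filter_upwards [eventually_ge_atTop 1] with N hN
      have h3 := norm_mhs_le (hb N hN) ks n
      rw [one_pow, one_mul] at h3
      have hN' : (1 : ℝ) ≤ N := by exact_mod_cast hN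
      have h4 : ‖((n : ℂ) + 1 - (α - N))⁻¹‖ ≤ 1 / (N : ℝ) := by
        rw [norm_inv, ← one_div]
        exact one_div_le_one_div_of_le (by positivity)
          (by linarith [hre N n, (Nat.cast_nonneg n : (0 : ℝ) ≤ n)])
      have h5 : ‖((n : ℂ) + 1 - (α - N))⁻¹‖ ^ k ≤ 1 / (N : ℝ) :=
        (pow_le_of_le_one (norm_nonneg _) (h4.trans (by
          rw [div_le_one (by positivity)]; exact hN'))
          (Nat.one_le_iff_ne_zero.mp (hl.1 k List.mem_cons_self))).trans h4
      rw [norm_mul, one_div, ← inv_pow, norm_pow]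
      exact mul_le_mul h5 h3 (norm_nonneg _) (by positivity))
    (by
      filter_upwards [eventually_ge_atTop 1] with N hN n
      exact norm_mhs_term_le (hb N hN) hl n)
  rw [tsum_zero] at key
  refine key.congr' ?_
  filter_upwards [eventually_ge_atTop 1] with N hN
  exact (hmzv_cons_eq_tsum (hb N hN) hl).symm

/-! ### The evaluation without derivatives -/

/-- The alternating sum of products of multiple zeta values and interpolated star sums. -/
noncomputable def antipodeSum (m : List ℕ) (α : ℂ) : ℂ :=
  ∑ j ∈ Finset.range (m.length + 1),
    (-1 : ℂ) ^ j * mzv (m.drop j).reverse * starInterp (m.take j) α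

/-- The `j = 0` term is constant in `α` and cancels; the others lose their first part `k`, and the
index shift produces the sign. -/
lemma antipodeSum_cons_sub_one {α : ℂ} (hα : α.re < 1) {k : ℕ} (hk : 1 ≤ k) (ks : List ℕ) :
    antipodeSum (k :: ks) (α - 1) - antipodeSum (k :: ks) α =
      -(1 / (1 - α) ^ k * antipodeSum ks (α - 1)) := by
  simp only [antipodeSum, List.length_cons]
  rw [Finset.sum_range_succ' _ (ks.length + 1), Finset.sum_range_succ' _ (ks.length + 1),
    add_sub_add_comm, ← Finset.sum_sub_distrib,
    Finset.mul_sum, ← Finset.sum_neg_distrib]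
  simp only [List.take_zero, starInterp_nil, sub_self, add_zero, List.drop_succ_cons,
    List.take_succ_cons]
  refine Finset.sum_congr rfl fun j _ => ?_
  have := starInterp_cons_sub_one hα hk (ks.take j)
  rw [pow_succ]
  linear_combination (-1 : ℂ) ^ j * -1 * mzv (ks.drop j).reverse * this

lemma antipodeSum_zero (k : ℕ) (ks : List ℕ) :
    antipodeSum (k :: ks) 0 = mzv (k :: ks).reverse := by
  rw [antipodeSum, Finset.sum_range_succ']
  simp [starInterp_cons_zero, starInterp_nil]

lemma tendsto_antipodeSum_sub {α : ℂ} (hα : α.re < 1) (m : List ℕ) :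
    Tendsto (fun N : ℕ => antipodeSum m (α - N) - antipodeSum m (0 - N)) atTop (𝓝 0) := by
  have h := tendsto_finsetSum (Finset.range (m.length + 1)) fun j _ =>
    (tendsto_starInterp_sub hα (m.take j)).const_mul ((-1 : ℂ) ^ j * mzv (m.drop j).reverse)
  simp only [mul_zero, Finset.sum_const_zero] at h
  refine h.congr fun N => ?_
  rw [antipodeSum, antipodeSum, ← Finset.sum_sub_distrib]
  exact Finset.sum_congr rfl fun j _ => mul_sub _ _ _

theorem antipodeSum_eq_hmzv (m : List ℕ) (hm : Admissible m.reverse) {α : ℂ} (hα : α.re < 1) :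
    antipodeSum m α = hmzv m.reverse (1 - α) := by
  induction m generalizing α with
  | nil => simp [antipodeSum, hmzv_nil, mzv, starInterp]
  | cons k ks ih =>
    rw [List.reverse_cons] at hm
    have ih' := fun {β : ℂ} hβ => ih hm.of_append_singleton (α := β) hβ
    have hk : 1 ≤ k := hm.1 k (by simp)
    set d : ℂ → ℂ := fun β => antipodeSum (k :: ks) β - hmzv (ks.reverse ++ [k]) (1 - β) with hd
    have hstep : ∀ β : ℂ, β.re < 1 → d (β - 1) = d β := fun β hβ => by
      have h1 := antipodeSum_cons_sub_one hβ hk ks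
      have h2 := hmzv_append_singleton hm β
      rw [ih' (re_sub_one_lt hβ)] at h1
      simp only [hd]
      linear_combination h1 + h2
    have hper : ∀ (N : ℕ) (β : ℂ), β.re < 1 → d (β - N) = d β := fun N => by
      induction N with
      | zero => simp
      | succ N ihN =>
        intro β hβ
        rw [Nat.cast_succ, show β - ((N : ℂ) + 1) = β - 1 - N by ring, ihN _ (re_sub_one_lt hβ),
          hstep β hβ]
    have h0 : d 0 = 0 := by
      simp only [hd]
      rw [antipodeSum_zero, List.reverse_cons, mzv, sub_zero, sub_self]
    have h1 := (tendsto_antipodeSum_sub hα (k :: ks)).sub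
      ((tendsto_hmzv_sub_natCast hm (by simp) hα).sub
        (tendsto_hmzv_sub_natCast hm (by simp) (α := 0) (by simp)))
    simp only [sub_zero] at h1
    have h2 : d α = 0 := by
      refine tendsto_nhds_unique (tendsto_const_nhds.congr fun N => ?_) h1
      have h3 := hper N α hα
      have h4 := hper N 0 (by simp)
      simp only [hd] at h3 h4 h0 ⊢
      linear_combination h4 - h3 + h0
    rw [List.reverse_cons]
    exact sub_eq_zero.mp h2

/-! ### Taylor coefficients -/

/-- The `k`-th Taylor coefficient of `f` at `α`. -/
noncomputable def taylorCoeff (k : ℕ) (f : ℂ → ℂ) (α : ℂ) : ℂ :=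
  iteratedDeriv k f α / (k.factorial : ℂ)

lemma taylorCoeff_congr {f g : ℂ → ℂ} {α : ℂ} (h : f =ᶠ[𝓝 α] g) (k : ℕ) :
    taylorCoeff k f α = taylorCoeff k g α := by
  rw [taylorCoeff, taylorCoeff, h.iteratedDeriv_eq k]

lemma taylorCoeff_zero (f : ℂ → ℂ) (α : ℂ) : taylorCoeff 0 f α = f α := by
  simp [taylorCoeff]

lemma taylorCoeff_const (k : ℕ) (c α : ℂ) :
    taylorCoeff k (fun _ => c) α = if k = 0 then c else 0 := by
  rw [taylorCoeff, iteratedDeriv_const]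
  split_ifs with h <;> simp [h]

lemma taylorCoeff_add {f g : ℂ → ℂ} {α : ℂ} (k : ℕ) (hf : AnalyticAt ℂ f α)
    (hg : AnalyticAt ℂ g α) :
    taylorCoeff k (fun β => f β + g β) α = taylorCoeff k f α + taylorCoeff k g α := by
  rw [taylorCoeff, iteratedDeriv_fun_add hf.contDiffAt hg.contDiffAt, add_div]
  rfl

lemma taylorCoeff_sum {ι : Type*} {s : Finset ι} {f : ι → ℂ → ℂ} {α : ℂ} (k : ℕ)
    (hf : ∀ i ∈ s, AnalyticAt ℂ (f i) α) :
    taylorCoeff k (fun β => ∑ i ∈ s, f i β) α = ∑ i ∈ s, taylorCoeff k (f i) α := by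
  rw [taylorCoeff, iteratedDeriv_fun_sum fun i hi => (hf i hi).contDiffAt, Finset.sum_div]
  rfl

/-- Normalising by `k!` turns the Leibniz rule into a Cauchy product. -/
lemma taylorCoeff_mul {f g : ℂ → ℂ} {α : ℂ} (k : ℕ) (hf : AnalyticAt ℂ f α)
    (hg : AnalyticAt ℂ g α) :
    taylorCoeff k (fun β => f β * g β) α =
      ∑ p ∈ Finset.HasAntidiagonal.antidiagonal k, taylorCoeff p.1 f α * taylorCoeff p.2 g α := by
  rw [taylorCoeff, show (fun β => f β * g β) = f * g from rfl,
    iteratedDeriv_mul hf.contDiffAt hg.contDiffAt,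
    Finset.Nat.sum_antidiagonal_eq_sum_range_succ
      (fun i j => taylorCoeff i f α * taylorCoeff j g α), Finset.sum_div]
  refine Finset.sum_congr rfl fun i hi => ?_
  have hik : i ≤ k := Nat.lt_succ_iff.mp (Finset.mem_range.mp hi)
  have h := Nat.choose_mul_factorial_mul_factorial hik
  have h' : (k.choose i : ℂ) * i.factorial * (k - i).factorial = k.factorial := by exact_mod_cast h
  have h1 : (i.factorial : ℂ) ≠ 0 := Nat.cast_ne_zero.mpr i.factorial_ne_zero
  have h2 : ((k - i).factorial : ℂ) ≠ 0 := Nat.cast_ne_zero.mpr (k - i).factorial_ne_zero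
  have h3 : (k.factorial : ℂ) ≠ 0 := Nat.cast_ne_zero.mpr k.factorial_ne_zero
  rw [taylorCoeff, taylorCoeff, div_mul_div_comm, div_eq_div_iff h3 (mul_ne_zero h1 h2), ← h']
  ring

lemma taylorCoeff_const_mul {f : ℂ → ℂ} {α : ℂ} (k : ℕ) (c : ℂ) :
    taylorCoeff k (fun β => c * f β) α = c * taylorCoeff k f α := by
  rw [taylorCoeff, taylorCoeff, iteratedDeriv_const_mul_field, mul_div_assoc]

lemma iteratedDeriv_inv_sub_pow (c : ℂ) (m i : ℕ) {α : ℂ} (hα : c - α ≠ 0) :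
    iteratedDeriv i (fun β => 1 / (c - β) ^ m) α =
      (m.ascFactorial i : ℂ) * (1 / (c - α) ^ (m + i)) := by
  induction i generalizing α with
  | zero => simp
  | succ i ih =>
    have hev : iteratedDeriv i (fun β => 1 / (c - β) ^ m) =ᶠ[𝓝 α]
        fun β => (m.ascFactorial i : ℂ) * (1 / (c - β) ^ (m + i)) := by
      have : ∀ᶠ β in 𝓝 α, c - β ≠ 0 :=
        (continuous_const.sub continuous_id).continuousAt.eventually_ne hα
      filter_upwards [this] with β hβ using ih hβ
    rw [iteratedDeriv_succ, hev.deriv_eq]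
    have h1 : HasDerivAt (fun β => c - β) (-1) α := by
      simpa using (hasDerivAt_id α).const_sub c
    have h2 := ((h1.pow (m + i)).inv (pow_ne_zero _ hα)).const_mul (m.ascFactorial i : ℂ)
    have h3 : (fun β => (m.ascFactorial i : ℂ) * (1 / (c - β) ^ (m + i))) =
        fun β => (m.ascFactorial i : ℂ) * ((fun β => c - β) ^ (m + i))⁻¹ β := by
      funext β
      simp
    rw [h3, h2.deriv, Nat.ascFactorial_succ]
    simp only [Pi.pow_apply]
    push_cast
    -- The derivative of a power involves the truncated exponent `m + i - 1`, so `m + i = 0` is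
    -- separate.
    rcases Nat.eq_zero_or_pos (m + i) with h0 | h0
    · have hm : m = 0 := by omega
      have hi : i = 0 := by omega
      subst hm hi
      simp
    · obtain ⟨t, ht⟩ : ∃ t, m + i = t + 1 := ⟨m + i - 1, by omega⟩
      rw [← add_assoc, ht, Nat.add_sub_cancel, ← Nat.cast_add, ht]
      field_simp
      ring

lemma taylorCoeff_inv_sub_pow (c : ℂ) (m i : ℕ) {α : ℂ} (hα : c - α ≠ 0) :
    taylorCoeff i (fun β => 1 / (c - β) ^ m) α =
      ((m + i - 1).choose i : ℂ) * (1 / (c - α) ^ (m + i)) := by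
  rw [taylorCoeff, iteratedDeriv_inv_sub_pow c m i hα, Nat.ascFactorial_eq_factorial_mul_choose']
  have : (i.factorial : ℂ) ≠ 0 := Nat.cast_ne_zero.mpr i.factorial_ne_zero
  push_cast
  field_simp

lemma natCast_add_one_sub_ne_zero {α : ℂ} (hα : α.re < 1) (n : ℕ) : (n : ℂ) + 1 - α ≠ 0 := by
  intro h
  have h1 := congrArg Complex.re h
  simp only [Complex.sub_re, Complex.add_re, Complex.natCast_re, Complex.one_re,
    Complex.zero_re] at h1
  linarith [(Nat.cast_nonneg n : (0 : ℝ) ≤ n)]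

lemma analyticAt_inv_sub_pow {c α : ℂ} (m : ℕ) (hα : c - α ≠ 0) :
    AnalyticAt ℂ (fun β => 1 / (c - β) ^ m) α :=
  analyticAt_const.div ((analyticAt_const.sub analyticAt_id).pow m) (pow_ne_zero m hα)

lemma analyticAt_mhs {α : ℂ} (hα : α.re < 1) (l : List ℕ) (n : ℕ) :
    AnalyticAt ℂ (fun β => mhs l (1 - β) n) α := by
  induction l generalizing n with
  | nil => exact analyticAt_const
  | cons k ks ih =>
    simp only [mhs_cons_one_sub]
    exact Finset.analyticAt_fun_sum _ fun i _ =>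
      (analyticAt_inv_sub_pow k (natCast_add_one_sub_ne_zero hα i)).mul (ih i)

lemma sum_antidiagonalTuple_succ {M : Type*} [AddCommMonoid M] (q k : ℕ)
    (f : (Fin (q + 1) → ℕ) → M) :
    ∑ i ∈ Finset.Nat.antidiagonalTuple (q + 1) k, f i =
      ∑ p ∈ Finset.HasAntidiagonal.antidiagonal k, ∑ i ∈ Finset.Nat.antidiagonalTuple q p.2, f (Fin.cons p.1 i) := by
  rw [Finset.sum_sigma']
  refine Finset.sum_bij' (fun i _ => ⟨(i 0, ∑ j, Fin.tail i j), Fin.tail i⟩)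
    (fun x _ => Fin.cons x.1.1 x.2) ?_ ?_ ?_ ?_ ?_
  · intro i hi
    rw [Finset.Nat.mem_antidiagonalTuple, Fin.sum_univ_succ] at hi
    simp [Finset.Nat.mem_antidiagonalTuple, Fin.tail, hi]
  · rintro ⟨⟨a, b⟩, i⟩ hx
    simp only [Finset.mem_sigma, Finset.HasAntidiagonal.mem_antidiagonal, Finset.Nat.mem_antidiagonalTuple] at hx
    simp [Finset.Nat.mem_antidiagonalTuple, Fin.sum_univ_succ, hx]
  · intro i _
    simp
  · rintro ⟨⟨a, b⟩, i⟩ hx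
    simp only [Finset.mem_sigma, Finset.HasAntidiagonal.mem_antidiagonal, Finset.Nat.mem_antidiagonalTuple] at hx
    obtain ⟨-, rfl⟩ := hx
    simp
  · intro i _
    simp

lemma taylorCoeff_mhs {α : ℂ} (hα : α.re < 1) (q : ℕ) (m : Fin q → ℕ) (k n : ℕ) :
    taylorCoeff k (fun β => mhs (List.ofFn m) (1 - β) n) α =
      ∑ i ∈ Finset.Nat.antidiagonalTuple q k, (∏ j, ((m j + i j - 1).choose (i j) : ℂ)) *
        mhs (List.ofFn fun j => m j + i j) (1 - α) n := by
  induction q generalizing k n with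
  | zero =>
    simp only [List.ofFn_zero, mhs, taylorCoeff_const]
    cases k with
    | zero => simp [Finset.Nat.antidiagonalTuple_zero_zero]
    | succ k => simp [Finset.Nat.antidiagonalTuple_zero_succ]
  | succ q ih =>
    rw [sum_antidiagonalTuple_succ]
    simp only [List.ofFn_succ, mhs_cons_one_sub, Fin.prod_univ_succ, Fin.cons_zero, Fin.cons_succ]
    rw [taylorCoeff_sum (f := fun (i : ℕ) β =>
      1 / ((i : ℂ) + 1 - β) ^ m 0 * mhs (List.ofFn fun j => m j.succ) (1 - β) i) k
      fun i _ => (analyticAt_inv_sub_pow (m 0)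
      (natCast_add_one_sub_ne_zero hα i)).mul (analyticAt_mhs hα _ i)]
    simp only [taylorCoeff_mul k (analyticAt_inv_sub_pow (m 0)
      (natCast_add_one_sub_ne_zero hα _)) (analyticAt_mhs hα _ _),
      taylorCoeff_inv_sub_pow _ _ _ (natCast_add_one_sub_ne_zero hα _), ih, Finset.mul_sum]
    rw [Finset.sum_comm]
    refine Finset.sum_congr rfl fun p _ => ?_
    rw [Finset.sum_comm]
    refine Finset.sum_congr rfl fun i _ => Finset.sum_congr rfl fun t _ => ?_
    ring

lemma reverse_ofFn {X : Type*} {q : ℕ} (f : Fin q → X) :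
    (List.ofFn f).reverse = List.ofFn fun j => f j.rev := by
  refine List.ext_getElem (by simp) fun i h1 h2 => ?_
  simp only [List.getElem_reverse, List.getElem_ofFn]
  congr 1
  ext
  simp only [List.length_ofFn, Fin.val_rev]
  omega

lemma taylorCoeff_mhs_reverse {α : ℂ} (hα : α.re < 1) (q : ℕ) (m : Fin q → ℕ) (k n : ℕ) :
    taylorCoeff k (fun β => mhs (List.ofFn m).reverse (1 - β) n) α =
      ∑ i ∈ Finset.Nat.antidiagonalTuple q k, (∏ j, ((m j + i j - 1).choose (i j) : ℂ)) *
        mhs (List.ofFn fun j => m j + i j).reverse (1 - α) n := by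
  simp only [reverse_ofFn]
  rw [taylorCoeff_mhs hα]
  refine Finset.sum_bij' (fun i _ j => i j.rev) (fun i _ j => i j.rev) ?_ ?_ ?_ ?_ ?_
  · intro i hi
    rw [Finset.Nat.mem_antidiagonalTuple] at hi ⊢
    rw [← hi]
    exact Equiv.sum_comp Fin.revPerm i
  · intro i hi
    rw [Finset.Nat.mem_antidiagonalTuple] at hi ⊢
    rw [← hi]
    exact Equiv.sum_comp Fin.revPerm i
  · intro i _
    simp
  · intro i _
    simp
  · intro i _
    simp only [Fin.rev_rev]
    congr 1
    exact (Equiv.prod_comp Fin.revPerm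
      fun j => ((m j + i j.rev - 1).choose (i j.rev) : ℂ)).symm.trans (by simp) |>.symm

/-! ### Taylor coefficients of the rising-factorial ratios. -/

lemma analyticAt_riseRatio (n : ℕ) (α : ℂ) : AnalyticAt ℂ (riseRatio n) α :=
  (differentiable_riseRatio n).analyticAt α

lemma taylorCoeff_linear_succ_succ (c d : ℂ) (i : ℕ) (α : ℂ) :
    taylorCoeff (i + 2) (fun β => (β + c) / d) α = 0 := by
  have h : deriv (fun β : ℂ => (β + c) / d) = fun _ => 1 / d := by
    funext β
    simp
  rw [taylorCoeff, iteratedDeriv_succ', h, iteratedDeriv_const]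
  simp

lemma taylorCoeff_linear_one (c d : ℂ) (α : ℂ) :
    taylorCoeff 1 (fun β => (β + c) / d) α = 1 / d := by
  simp [taylorCoeff, iteratedDeriv_one]

lemma mhs_replicate_succ (k : ℕ) (α : ℂ) (n : ℕ) :
    mhs (List.replicate (k + 1) 1) α (n + 1) = mhs (List.replicate (k + 1) 1) α n +
      1 / (α + n) * mhs (List.replicate k 1) α n := by
  rw [List.replicate_succ, mhs, mhs, Finset.sum_Icc_succ_top (by omega), Nat.add_sub_cancel, pow_one]
  push_cast
  rw [show (n : ℂ) + 1 + α - 1 = α + n by ring]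

/-- `riseRatio n` is a product of linear factors, so dividing its Taylor coefficient by its value
gives the elementary symmetric polynomial of degree `k` in `1 / (α + i)`, `i < n`. -/
lemma taylorCoeff_riseRatio {α : ℂ} (hα : ∀ n : ℕ, α + n ≠ 0) (k n : ℕ) :
    taylorCoeff k (riseRatio n) α = riseRatio n α * mhs (List.replicate k 1) α n := by
  induction n generalizing k with
  | zero =>
    rw [show riseRatio 0 = fun _ => 1 from funext riseRatio_zero, taylorCoeff_const]
    cases k <;> simp [mhs, List.replicate_succ]
  | succ n ih =>
    have hn : (n : ℂ) + 1 ≠ 0 := Nat.cast_add_one_ne_zero n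
    cases k with
    | zero => simp [taylorCoeff_zero, mhs]
    | succ k =>
      have h1 : riseRatio (n + 1) = fun β => (β + n) / ((n : ℂ) + 1) * riseRatio n β := by
        funext β
        rw [riseRatio_succ, mul_comm]
      have hlin : AnalyticAt ℂ (fun β : ℂ => (β + n) / ((n : ℂ) + 1)) α := by fun_prop
      rw [riseRatio_succ, h1, taylorCoeff_mul _ hlin (analyticAt_riseRatio n α),
        -- A linear factor has only Taylor coefficients of orders `0` and `1`; after the split, `(0,
        -- k)` stands for the order-one term.
        Finset.Nat.sum_antidiagonal_succ, Finset.sum_eq_single (0, k)]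
      · rw [taylorCoeff_zero, zero_add, taylorCoeff_linear_one, ih, ih, mhs_replicate_succ]
        have := hα n
        field_simp
      · rintro ⟨i, j⟩ hij hne
        cases i with
        | zero =>
          rw [Finset.HasAntidiagonal.mem_antidiagonal] at hij
          simp only [zero_add] at hij
          exact absurd (by rw [hij]) hne
        | succ i => rw [taylorCoeff_linear_succ_succ, zero_mul]
      · intro h
        simp at h

/-! ### Locally uniform convergence -/

lemma tendstoLocallyUniformlyOn_of_exists_nhds {ι : Type*} {p : Filter ι} {F : ι → ℂ → ℂ}
    {f : ℂ → ℂ} {U : Set ℂ} (h : ∀ x ∈ U, ∃ t ∈ 𝓝 x, TendstoUniformlyOn F f p t) :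
    TendstoLocallyUniformlyOn F f p U := fun u hu x hx => by
  obtain ⟨t, ht, h'⟩ := h x hx
  exact ⟨t, mem_nhdsWithin_of_mem_nhds ht, h' u hu⟩

lemma differentiableOn_iteratedDeriv {f : ℂ → ℂ} {U : Set ℂ} (hU : IsOpen U)
    (hf : DifferentiableOn ℂ f U) (k : ℕ) : DifferentiableOn ℂ (iteratedDeriv k f) U := by
  induction k with
  | zero => simpa using hf
  | succ k ih =>
    rw [iteratedDeriv_succ]
    exact ih.deriv hU

lemma tendstoLocallyUniformlyOn_iteratedDeriv {ι : Type*} {p : Filter ι} [p.NeBot]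
    {F : ι → ℂ → ℂ} {f : ℂ → ℂ} {U : Set ℂ} (hU : IsOpen U)
    (h : TendstoLocallyUniformlyOn F f p U) (hF : ∀ n, DifferentiableOn ℂ (F n) U) (k : ℕ) :
    TendstoLocallyUniformlyOn (fun n => iteratedDeriv k (F n)) (iteratedDeriv k f) p U := by
  induction k with
  | zero => simpa using h
  | succ k ih =>
    have := ih.deriv (Eventually.of_forall fun n => differentiableOn_iteratedDeriv hU (hF n) k) hU
    simp only [iteratedDeriv_succ]
    exact this

/-- Weierstrass: derivatives of holomorphic functions pass to locally uniform limits. A general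
filter allows finite partial sums indexed by `Finset ℕ`, hence `HasSum`. -/
lemma tendsto_taylorCoeff {ι : Type*} {p : Filter ι} [p.NeBot]
    {F : ι → ℂ → ℂ} {f : ℂ → ℂ} {U : Set ℂ} (hU : IsOpen U)
    (h : TendstoLocallyUniformlyOn F f p U) (hF : ∀ n, DifferentiableOn ℂ (F n) U) (k : ℕ)
    {α : ℂ} (hα : α ∈ U) :
    Tendsto (fun n => taylorCoeff k (F n) α) p (𝓝 (taylorCoeff k f α)) :=
  ((tendstoLocallyUniformlyOn_iteratedDeriv hU h hF k).tendsto_at hα).div_const _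

lemma isOpen_re_lt_one : IsOpen {α : ℂ | α.re < 1} :=
  isOpen_lt Complex.continuous_re continuous_const

lemma tendstoLocallyUniformlyOn_mhs {l : List ℕ} (hl : Admissible l) :
    TendstoLocallyUniformlyOn (fun n α => mhs l (1 - α) n) (fun α => hmzv l (1 - α)) atTop
      {α : ℂ | α.re < 1} := by
  refine tendstoLocallyUniformlyOn_of_exists_nhds fun α hα => ?_
  simp only [Set.mem_ofPred_eq] at hα
  have hs : 0 < min 1 ((1 - α.re) / 2) := lt_min one_pos (by linarith)
  refine ⟨{β | β.re < 1 - min 1 ((1 - α.re) / 2)},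
    (isOpen_lt Complex.continuous_re continuous_const).mem_nhds ?_,
    tendstoUniformlyOn_mhs (fun β hβ => norm_inv_le_of_re_le hs (min_le_left _ _) (le_of_lt hβ)) hl⟩
  have := min_le_right 1 ((1 - α.re) / 2)
  simp only [Set.mem_ofPred_eq]
  linarith

lemma differentiableOn_mhs (l : List ℕ) (n : ℕ) :
    DifferentiableOn ℂ (fun α => mhs l (1 - α) n) {α : ℂ | α.re < 1} := fun _ hα =>
  (analyticAt_mhs hα l n).differentiableAt.differentiableWithinAt

lemma analyticAt_hmzv {l : List ℕ} (hl : Admissible l) {α : ℂ} (hα : α.re < 1) :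
    AnalyticAt ℂ (fun β => hmzv l (1 - β)) α :=
  ((tendstoLocallyUniformlyOn_mhs hl).differentiableOn
    (Eventually.of_forall fun n => differentiableOn_mhs l n) isOpen_re_lt_one).analyticAt
    (isOpen_re_lt_one.mem_nhds hα)

lemma tendstoLocallyUniformlyOn_newtonSum (w : List Bool) :
    TendstoLocallyUniformlyOn
      (fun (t : Finset ℕ) α => ∑ n ∈ t, riseRatio (n + 1) α * (starTerm w n : ℂ))
      (newtonSum (starTerm w)) atTop {α : ℂ | α.re < 1} := by
  refine tendstoLocallyUniformlyOn_of_exists_nhds fun α hα => ?_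
  simp only [Set.mem_ofPred_eq] at hα
  have hs : 0 < (1 - α.re) / 2 := by linarith
  obtain ⟨u, hu, h⟩ := exists_summable_bound hs (‖α - 1‖ + 1) w
  refine ⟨{β | β.re < 1 - (1 - α.re) / 2} ∩ {β | ‖β - 1‖ < ‖α - 1‖ + 1},
    inter_mem ((isOpen_lt Complex.continuous_re continuous_const).mem_nhds ?_)
      ((isOpen_lt (by fun_prop) continuous_const).mem_nhds ?_),
    tendstoUniformlyOn_tsum hu fun n β hβ => ?_⟩
  · simp only [Set.mem_ofPred_eq]
    linarith
  · simp
  · rw [norm_mul, Complex.norm_real, Real.norm_eq_abs, abs_of_nonneg (starTerm_nonneg w n)]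
    exact (h β hβ.1.le hβ.2.le n).2

lemma differentiableOn_sum_riseRatio (w : List Bool) (t : Finset ℕ) (U : Set ℂ) :
    DifferentiableOn ℂ (fun α => ∑ n ∈ t, riseRatio (n + 1) α * (starTerm w n : ℂ)) U :=
  (Differentiable.fun_sum fun n _ =>
    (differentiable_riseRatio (n + 1)).mul_const _).differentiableOn

lemma analyticAt_newtonSum (w : List Bool) {α : ℂ} (hα : α.re < 1) :
    AnalyticAt ℂ (newtonSum (starTerm w)) α :=
  ((tendstoLocallyUniformlyOn_newtonSum w).differentiableOn
    (Eventually.of_forall fun t => differentiableOn_sum_riseRatio w t _)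
    isOpen_re_lt_one).analyticAt (isOpen_re_lt_one.mem_nhds hα)

lemma hasSum_taylorCoeff_newtonSum (w : List Bool) (k : ℕ) {α : ℂ} (hα : α.re < 1)
    (hα' : ∀ n : ℕ, α + n ≠ 0) :
    HasSum (fun n => riseRatio (n + 1) α * mhs (List.replicate k 1) α (n + 1) * (starTerm w n : ℂ))
      (taylorCoeff k (newtonSum (starTerm w)) α) := by
  refine (tendsto_taylorCoeff isOpen_re_lt_one (tendstoLocallyUniformlyOn_newtonSum w)
    (fun t => differentiableOn_sum_riseRatio w t _) k hα).congr fun t => ?_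
  rw [taylorCoeff_sum (f := fun n β => riseRatio (n + 1) β * (starTerm w n : ℂ)) k
    fun n _ => (analyticAt_riseRatio (n + 1) α).mul analyticAt_const]
  refine Finset.sum_congr rfl fun n _ => ?_
  simp only [mul_comm _ (starTerm w n : ℂ)]
  rw [taylorCoeff_const_mul, taylorCoeff_riseRatio hα']

/-! ### The main theorem -/

lemma gbinom_eq_riseRatio {α : ℂ} (hα : ∀ n : ℕ, α + n ≠ 0) (n : ℕ) :
    gbinom (n + α - 1) n = riseRatio n α := by
  have h1 : ∀ n : ℕ, Complex.Gamma (α + n) = (∏ i ∈ Finset.range n, (α + i)) * Complex.Gamma α := by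
    intro n
    induction n with
    | zero => simp
    | succ n ih =>
      rw [Nat.cast_succ, ← add_assoc, Complex.Gamma_add_one _ (hα n), ih, Finset.prod_range_succ]
      ring
  have h2 : Complex.Gamma α ≠ 0 :=
    Complex.Gamma_ne_zero fun m h => hα m (by rw [h]; ring)
  have h3 : (n.factorial : ℂ) ≠ 0 := Nat.cast_ne_zero.mpr n.factorial_ne_zero
  rw [gbinom, Complex.Gamma_nat_eq_factorial, show (n : ℂ) + α - 1 + 1 = α + n by ring,
    show (n : ℂ) + α - 1 - n + 1 = α by ring, h1, riseRatio]
  field_simp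

/-- Lowering the first part by one deletes the leading comma of the dual word, and that comma is
exactly the explicit `1 / n`; this is where `m_1 ≥ 2` enters. -/
lemma aperyTerm_hoffmanDual {α : ℂ} (hα : ∀ n : ℕ, α + n ≠ 0) (k : ℕ) {a : ℕ} (ha : 2 ≤ a)
    (l : List ℕ) (n : ℕ) :
    aperyTerm k α (hoffmanDual ((a :: l).modifyHead (· - 1))) (n + 1) =
      riseRatio (n + 1) α * mhs (List.replicate k 1) α (n + 1) *
        (starTerm ((separators (a :: l)).map not) n : ℂ) := by
  have hsep : (separators (a :: l)).map not = true :: (separators ((a - 1) :: l)).map not := by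
    obtain ⟨b, rfl⟩ : ∃ b, a = b + 2 := ⟨a - 2, by omega⟩
    cases l <;> simp [separators, List.replicate_succ]
  rw [hsep, starTerm_true, aperyTerm, gbinom_eq_riseRatio hα, List.modifyHead_cons, hoffmanDual]
  push_cast
  ring

lemma Admissible.take {l : List ℕ} (h : Admissible l) (n : ℕ) : Admissible (l.take n) := by
  refine ⟨fun k hk => h.1 k (List.mem_of_mem_take hk), fun k hk => h.2 k ?_⟩
  cases n with
  | zero => simp at hk
  | succ n =>
    cases l with
    | nil => simp at hk
    | cons a l => simpa using hk

lemma admissible_reverse_ofFn {q : ℕ} {m : Fin (q + 1) → ℕ} (h1 : ∀ j, 1 ≤ m j)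
    (h2 : 2 ≤ m (Fin.last q)) : Admissible (List.ofFn m).reverse := by
  rw [reverse_ofFn]
  refine ⟨fun k hk => ?_, fun k hk => ?_⟩
  · obtain ⟨j, rfl⟩ := (List.mem_ofFn' _ _).mp hk
    exact h1 _
  · rw [List.ofFn_succ] at hk
    simp only [List.head?_cons, Option.mem_some_iff, Fin.rev_zero] at hk
    omega

/-- The `j = 0` term of `antipodeSum` is the subtracted zeta value; in the rest, the sign in
`starInterp` absorbs the shift of `j`. -/
lemma sum_newtonSum_eq {a : ℕ} {l : List ℕ} (h : Admissible (a :: l).reverse) {α : ℂ}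
    (hα : α.re < 1) :
    ∑ j ∈ Finset.range (l.length + 1), (-1 : ℂ) ^ j * mzv (l.drop j).reverse *
        newtonSum (starTerm ((separators (a :: l.take j)).map not)) α =
      hmzv (a :: l).reverse (1 - α) - mzv (a :: l).reverse := by
  rw [← antipodeSum_eq_hmzv _ h hα, antipodeSum, List.length_cons,
    Finset.sum_range_succ' _ (l.length + 1)]
  simp only [List.drop_succ_cons, List.take_succ_cons, starInterp, List.drop_zero, List.take_zero,
    pow_zero, one_mul, mul_one, add_sub_cancel_right]
  refine Finset.sum_congr rfl fun j _ => ?_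
  rw [pow_succ]
  ring

lemma sum_taylorCoeff_newtonSum_eq {a : ℕ} {l : List ℕ} (h : Admissible (a :: l).reverse) {α : ℂ}
    (hα : α.re < 1) (k : ℕ) :
    ∑ j ∈ Finset.range (l.length + 1), (-1 : ℂ) ^ j * mzv (l.drop j).reverse *
        taylorCoeff k (newtonSum (starTerm ((separators (a :: l.take j)).map not))) α =
      taylorCoeff k (fun β => hmzv (a :: l).reverse (1 - β)) α -
        (if k = 0 then 1 else 0) * mzv (a :: l).reverse := by
  set f := fun (j : ℕ) (β : ℂ) => (-1 : ℂ) ^ j * mzv (l.drop j).reverse *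
    newtonSum (starTerm ((separators (a :: l.take j)).map not)) β
  have hf : ∀ j ∈ Finset.range (l.length + 1), AnalyticAt ℂ (f j) α := fun j _ =>
    analyticAt_const.mul (analyticAt_newtonSum _ hα)
  have hev : (fun β => hmzv (a :: l).reverse (1 - β)) =ᶠ[𝓝 α] fun β =>
      ∑ j ∈ Finset.range (l.length + 1), f j β + mzv (a :: l).reverse := by
    filter_upwards [isOpen_re_lt_one.mem_nhds hα] with β hβ
    rw [sum_newtonSum_eq h hβ, sub_add_cancel]
  rw [taylorCoeff_congr hev, taylorCoeff_add k (Finset.analyticAt_fun_sum _ hf) analyticAt_const,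
    taylorCoeff_sum k hf, taylorCoeff_const, ite_mul, one_mul, zero_mul, add_sub_cancel_right]
  exact Finset.sum_congr rfl fun j _ => (taylorCoeff_const_mul k _).symm

end HurwitzMZV

open HurwitzMZV in
theorem mainTheorem7 (k : ℕ) (α : ℂ) (hα : ∀ z : ℤ, α ≠ (z : ℂ)) (hre : α.re < 1)
    (q : ℕ) (m : Fin (q + 1) → ℕ) (hm : ∀ j, 1 ≤ m j)
    (hm_first : 2 ≤ m 0) (hm_last : 2 ≤ m (Fin.last q)) :
    -- every multiple zeta value below is a convergent limit
    (∀ j ∈ Finset.range (q + 2),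
      Tendsto (mhs ((List.ofFn m).drop j).reverse 1) atTop
        (𝓝 (mzv ((List.ofFn m).drop j).reverse))) ∧
    (∀ (i : Fin (q + 1) → ℕ) (a : ℂ), (∀ N : ℕ, 1 ≤ N → a ≠ (N : ℂ)) →
      Tendsto (mhs (List.ofFn fun j => m j + i j).reverse (1 - a)) atTop
        (𝓝 (hmzv (List.ofFn fun j => m j + i j).reverse (1 - a)))) ∧
    -- every series below converges
    (∀ j ∈ Finset.Icc 1 (q + 1),
      Summable fun n : ℕ =>
        aperyTerm k α (hoffmanDual (((List.ofFn m).take j).modifyHead (· - 1))) (n + 1)) ∧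
    -- the derivative below exists
    ContDiffAt ℂ k (fun a : ℂ => hmzv (List.ofFn m).reverse (1 - a)) α ∧
    -- the evaluation by a derivative
    (∑ j ∈ Finset.Icc 1 (q + 1), (-1 : ℂ) ^ (j - 1) * mzv ((List.ofFn m).drop j).reverse *
        ∑' n : ℕ,
          aperyTerm k α (hoffmanDual (((List.ofFn m).take j).modifyHead (· - 1))) (n + 1)
      = 1 / (k.factorial : ℂ) *
          iteratedDeriv k (fun a : ℂ => hmzv (List.ofFn m).reverse (1 - a)) α
        - (if k = 0 then 1 else 0) * mzv (List.ofFn m).reverse) ∧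
    -- the explicit evaluation
    (∑ j ∈ Finset.Icc 1 (q + 1), (-1 : ℂ) ^ (j - 1) * mzv ((List.ofFn m).drop j).reverse *
        ∑' n : ℕ,
          aperyTerm k α (hoffmanDual (((List.ofFn m).take j).modifyHead (· - 1))) (n + 1)
      = ∑ i ∈ Finset.Nat.antidiagonalTuple (q + 1) k,
          (∏ j, ((m j + i j - 1).choose (i j) : ℂ)) *
            hmzv (List.ofFn fun j => m j + i j).reverse (1 - α)
        - (if k = 0 then 1 else 0) * mzv (List.ofFn m).reverse) := by
  have hα' : ∀ n : ℕ, α + n ≠ 0 := fun n h => hα (-n) (by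
    push_cast
    exact eq_neg_of_add_eq_zero_left h)
  have hadm : ∀ i : Fin (q + 1) → ℕ, Admissible (List.ofFn fun j => m j + i j).reverse := fun i =>
    admissible_reverse_ofFn (fun j => (hm j).trans (Nat.le_add_right _ _))
      (hm_last.trans (Nat.le_add_right _ _))
  have hadm0 : Admissible (List.ofFn m).reverse := by simpa using hadm 0
  have hcons : List.ofFn m = m 0 :: List.ofFn fun j => m j.succ := List.ofFn_succ
  have hsum : ∀ j : ℕ, HasSum (fun n : ℕ =>
      aperyTerm k α (hoffmanDual (((List.ofFn m).take (j + 1)).modifyHead (· - 1))) (n + 1))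
      (taylorCoeff k (newtonSum (starTerm
        ((separators (m 0 :: (List.ofFn fun j => m j.succ).take j)).map not))) α) := fun j => by
    rw [hcons, List.take_succ_cons]
    simp only [aperyTerm_hoffmanDual hα' k hm_first]
    exact hasSum_taylorCoeff_newtonSum _ k hre hα'
  have hderiv : ∑ j ∈ Finset.Icc 1 (q + 1),
      (-1 : ℂ) ^ (j - 1) * mzv ((List.ofFn m).drop j).reverse * ∑' n : ℕ,
        aperyTerm k α (hoffmanDual (((List.ofFn m).take j).modifyHead (· - 1))) (n + 1) =
      taylorCoeff k (fun a : ℂ => hmzv (List.ofFn m).reverse (1 - a)) α -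
        (if k = 0 then 1 else 0) * mzv (List.ofFn m).reverse := by
    have h := sum_taylorCoeff_newtonSum_eq (hcons ▸ hadm0) hre k
    rw [List.length_ofFn, ← hcons] at h
    rw [sum_Icc_one, ← h]
    refine Finset.sum_congr rfl fun j _ => ?_
    rw [(hsum j).tsum_eq, Nat.add_sub_cancel, hcons, List.drop_succ_cons]
  have hexpl : taylorCoeff k (fun a : ℂ => hmzv (List.ofFn m).reverse (1 - a)) α =
      ∑ i ∈ Finset.Nat.antidiagonalTuple (q + 1) k,
        (∏ j, ((m j + i j - 1).choose (i j) : ℂ)) *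
          hmzv (List.ofFn fun j => m j + i j).reverse (1 - α) := by
    -- Both sides are limits of the Taylor coefficients of the truncated sums, where the expansion
    -- is a finite identity.
    refine tendsto_nhds_unique (tendsto_taylorCoeff isOpen_re_lt_one
      (tendstoLocallyUniformlyOn_mhs hadm0) (differentiableOn_mhs _) k hre) ?_
    simp only [taylorCoeff_mhs_reverse hre]
    exact tendsto_finsetSum _ fun i _ => (tendsto_mhs α (hadm i)).const_mul _
  refine ⟨fun j _ => ?_, fun i a _ => tendsto_mhs a (hadm i), fun j hj => ?_,
    (analyticAt_hmzv hadm0 hre).contDiffAt, ?_, ?_⟩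
  · have h : Admissible ((List.ofFn m).drop j).reverse := by
      rw [List.reverse_drop]
      exact hadm0.take _
    -- Ordinary multiple zeta values are the case `α = 0` of the parameter `1 - α`.
    simpa [mzv] using tendsto_mhs 0 h
  · obtain ⟨i, rfl⟩ : ∃ i, j = i + 1 := ⟨j - 1, by have := (Finset.mem_Icc.mp hj).1; omega⟩
    exact (hsum i).summable
  · rw [hderiv, taylorCoeff, div_eq_mul_one_div, mul_comm (iteratedDeriv _ _ _)]
  · rw [hderiv, hexpl]
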